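/- A basis $B$ of a finite-dimensional complex Hopf algebra $H$ is called *positive* if all structure constants of $H$ (multiplication, unit, comultiplication, counit, antipode) with respect to $B$ are non-negative. A quasi-triangular structure on $H$ is an invertible $R\in H\otimes H$ with $\tau\Delta(a)=R\Delta(a)R^{-1}$ for all $a\in H$, $(\Delta\otimes \mathrm{id})R=R_{13}R_{23}$, $(\mathrm{id}\otimes\Delta)R=R_{13}R_{12}$ and $(\varepsilon\otimes \mathrm{id})R=(\mathrm{id}\otimes\varepsilon)R=1$, where $\tau(a\otimes b)=b\otimes a$; it is *positive* with respect to $B$ if its coefficients in the basis $B\otimes B$ are non-negative. Let $G=G_+G_-$ be a unique factorization of a finite group into two subgroups; write $g=g_+g_-=\bar g_-\bar g_+$ with $g_+,\bar g_+\in G_+$ and $g_-,\bar g_-\in G_-$. For $u\in G_+$ and $x\in G_-$, let ${}^{u}x$ be the $G_-$-component of $ux$ with respect to the factorization $G=G_-G_+$, and let $x^{u}$ be the $G_-$-component of $xu$ with respect to $G=G_+G_-$. Let $H(G;G_+,G_-)$ be the Hopf algebra with basis $\{g\}$, $g\in G$, and $$\{g\}\{h\}=\delta_{\bar g_+,h_+}\{gh_-\},\quad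 1=\sum_{u\in G_+}\{u\},\quad \Delta\{g\}=\sum_{h\in G_+}\{g_+h^{-1}({}^{h}g_-)\}\otimes\{hg_-\},\quad \varepsilon\{g\}=\delta_{g_+,e},\quad S\{g\}=\{g^{-1}\}.$$ A positive (with respect to the basis $G$) quasi-triangular structure $R$ on $H(G;G_+,G_-)$ is called *normal* if there is a pair of group homomorphisms $\xi,\eta:G_+\to G_-$ with $\xi$ trivial ($\xi(u)=e$ for all $u\in G_+$), such that $G_+'=\{u\xi(u^{-1}):u\in G_+\}$ and $G_+''=\{\eta(u^{-1})u:u\in G_+\}$ are normal subgroups of $G$, $u\xi(u^{-1})\mapsto\eta(u)u^{-1}$ is a group isomorphism $G_+'\to G_+''$, and $$R=\sum_{u,v\in G_+}\{u(\eta(v)^{u})^{-1}\}\otimes\{v\xi(u)\}.$$ **Theorem.** Let $H$ be a finite-dimensional complex Hopf algebra with a positive basis $B$, and let $R$ be a quasi-triangular structure on $H$ that is positive with respect to $B$. Then $(H,R)$ is quasi-isomorphic to a normal pair: there are a unique factorization $G=G_+G_-$ of a finite group, a normal positive quasi-triangular structure $R'$ on $H'=H(G;G_+,G_-)$, an isomorphism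 of algebras $\phi:H'\to H$ with $\varepsilon\circ\phi=\varepsilon$, and an invertible element (twist) $T\in H\otimes H$ such that $$(\phi\otimes\phi)\Delta(a)=T\,\Delta(\phi(a))\,T^{-1}\ (a\in H'),\qquad (T\otimes1)(\Delta\otimes \mathrm{id})T=(1\otimes T)(\mathrm{id}\otimes\Delta)T,$$ $$(\varepsilon\otimes \mathrm{id})T=(\mathrm{id}\otimes\varepsilon)T=1,\qquad (\phi\otimes\phi)R'=\tau(T)\,R\,T^{-1}.$$ -/

import Mathlib

open scoped TensorProduct ComplexOrder

namespace PositiveHopf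

section Factorization

variable {G : Type*} [Group G] {P N : Subgroup G} (hPN : P.IsComplement' N)

/-- For a unique factorization `G = P N`, the component `g₊ ∈ P` in `g = g₊ g₋`. -/
noncomputable def plus (g : G) : G := (Subgroup.IsComplement.equiv hPN g).1

/-- For a unique factorization `G = P N`, the component `g₋ ∈ N` in `g = g₊ g₋`. -/
noncomputable def minus (g : G) : G := (Subgroup.IsComplement.equiv hPN g).2

/-- The component in `P` of `g` for the opposite factorization `g = ḡ₋ ḡ₊`. -/
noncomputable def barPlus (g : G) : G := (plus hPN g⁻¹)⁻¹

/-- The component in `N` of `g` for the opposite factorization `g = ḡ₋ ḡ₊`. -/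
noncomputable def barMinus (g : G) : G := (minus hPN g⁻¹)⁻¹

lemma plus_mem (g : G) : plus hPN g ∈ P := (Subgroup.IsComplement.equiv hPN g).1.2

lemma minus_mem (g : G) : minus hPN g ∈ N := (Subgroup.IsComplement.equiv hPN g).2.2

lemma barPlus_mem (g : G) : barPlus hPN g ∈ P := P.inv_mem (plus_mem hPN _)

lemma barMinus_mem (g : G) : barMinus hPN g ∈ N := N.inv_mem (minus_mem hPN _)

lemma plus_mul_minus (g : G) : plus hPN g * minus hPN g = g :=
  Subgroup.IsComplement.equiv_fst_mul_equiv_snd hPN g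

lemma barMinus_mul_barPlus (g : G) : barMinus hPN g * barPlus hPN g = g := by
  rw [barMinus, barPlus, ← mul_inv_rev, plus_mul_minus, inv_inv]

lemma plus_minus_unique {u x : G} (hu : u ∈ P) (hx : x ∈ N) :
    plus hPN (u * x) = u ∧ minus hPN (u * x) = x := by
  have h : Subgroup.IsComplement.equiv hPN (u * x) = (⟨u, hu⟩, ⟨x, hx⟩) := by
    rw [← Equiv.eq_symm_apply]
    rfl
  simp [plus, minus, h]

lemma plus_mul_of_mem {x : G} (g : G) (hx : x ∈ N) : plus hPN (g * x) = plus hPN g := by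
  conv_lhs => rw [← plus_mul_minus hPN g, mul_assoc]
  exact (plus_minus_unique hPN (plus_mem hPN g) (N.mul_mem (minus_mem hPN g) hx)).1

lemma minus_mul_of_mem {x : G} (g : G) (hx : x ∈ N) : minus hPN (g * x) = minus hPN g * x := by
  conv_lhs => rw [← plus_mul_minus hPN g, mul_assoc]
  exact (plus_minus_unique hPN (plus_mem hPN g) (N.mul_mem (minus_mem hPN g) hx)).2

lemma plus_of_mem_mul {u : G} (hu : u ∈ P) (g : G) : plus hPN (u * g) = u * plus hPN g := by
  conv_lhs => rw [← plus_mul_minus hPN g, ← mul_assoc]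
  exact (plus_minus_unique hPN (P.mul_mem hu (plus_mem hPN g)) (minus_mem hPN g)).1

lemma minus_of_mem_mul {u : G} (hu : u ∈ P) (g : G) : minus hPN (u * g) = minus hPN g := by
  conv_lhs => rw [← plus_mul_minus hPN g, ← mul_assoc]
  exact (plus_minus_unique hPN (P.mul_mem hu (plus_mem hPN g)) (minus_mem hPN g)).2

lemma barPlus_of_mem_mul {x : G} (hx : x ∈ N) (g : G) :
    barPlus hPN (x * g) = barPlus hPN g := by
  rw [barPlus, mul_inv_rev, plus_mul_of_mem hPN _ (N.inv_mem hx), barPlus]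

lemma barPlus_mul_of_mem (g : G) {u : G} (hu : u ∈ P) :
    barPlus hPN (g * u) = barPlus hPN g * u := by
  rw [barPlus, mul_inv_rev, plus_of_mem_mul hPN (P.inv_mem hu), barPlus, mul_inv_rev, inv_inv]

lemma plus_one : plus hPN 1 = 1 := by
  simpa using (plus_minus_unique hPN P.one_mem N.one_mem).1

lemma minus_one : minus hPN 1 = 1 := by
  simpa using (plus_minus_unique hPN P.one_mem N.one_mem).2

lemma barPlus_one : barPlus hPN 1 = 1 := by simp [barPlus, plus_one]

lemma plus_of_mem {u : G} (hu : u ∈ P) : plus hPN u = u := by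
  simpa [plus_one] using plus_of_mem_mul hPN hu 1

lemma minus_of_mem {u : G} (hu : u ∈ P) : minus hPN u = 1 := by
  simpa [minus_one] using minus_of_mem_mul hPN hu 1

lemma barPlus_of_mem {u : G} (hu : u ∈ P) : barPlus hPN u = u := by
  simpa [barPlus_one] using barPlus_mul_of_mem hPN 1 hu

lemma barPlus_of_mem_minus {x : G} (hx : x ∈ N) : barPlus hPN x = 1 := by
  simpa [barPlus_one] using barPlus_of_mem_mul hPN hx 1

lemma plus_of_mem_minus {x : G} (hx : x ∈ N) : plus hPN x = 1 := by
  simpa [plus_one] using plus_mul_of_mem hPN 1 hx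

lemma minus_of_mem_minus {x : G} (hx : x ∈ N) : minus hPN x = x := by
  simpa [minus_one] using minus_mul_of_mem hPN 1 hx

lemma barPlus_barPlus_mul (g k : G) : barPlus hPN (barPlus hPN g * k) = barPlus hPN (g * k) := by
  conv_rhs => rw [← barMinus_mul_barPlus hPN g, mul_assoc, barPlus_of_mem_mul hPN (barMinus_mem hPN g)]

lemma barMinus_eq (g : G) : barMinus hPN g = g * (barPlus hPN g)⁻¹ :=
  eq_mul_inv_of_mul_eq (barMinus_mul_barPlus hPN g)

lemma minus_eq (g : G) : minus hPN g = (plus hPN g)⁻¹ * g :=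
  eq_inv_mul_of_mul_eq (plus_mul_minus hPN g)

lemma plus_mul_barPlus_inv (g h : G) (hh : h ∈ P) :
    plus hPN (g * (barPlus hPN (h * minus hPN g))⁻¹) = plus hPN g * h⁻¹ := by
  have : g * (barPlus hPN (h * minus hPN g))⁻¹ =
      (plus hPN g * h⁻¹) * barMinus hPN (h * minus hPN g) := by
    rw [barMinus_eq]
    generalize barPlus hPN (h * minus hPN g) = b
    rw [minus_eq]
    group
  rw [this]
  exact (plus_minus_unique hPN (P.mul_mem (plus_mem hPN g) (P.inv_mem hh)) (barMinus_mem hPN _)).1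

lemma plus_mul_inv_mul_barMinus (g h : G) : plus hPN g * h⁻¹ * barMinus hPN (h * minus hPN g) =
    g * (barPlus hPN (h * minus hPN g))⁻¹ := by
  rw [barMinus_eq]
  generalize barPlus hPN (h * minus hPN g) = b
  rw [minus_eq]
  group

lemma minus_mul_barPlus_inv (g h : G) (hh : h ∈ P) :
    minus hPN (g * (barPlus hPN (h * minus hPN g))⁻¹) =
      h * minus hPN g * (barPlus hPN (h * minus hPN g))⁻¹ := by
  rw [minus_eq, plus_mul_barPlus_inv hPN g h hh]
  generalize barPlus hPN (h * minus hPN g) = b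
  rw [minus_eq]
  group

lemma barPlus_eq_one_iff (g : G) : barPlus hPN g = 1 ↔ plus hPN g = 1 := by
  constructor
  · intro hc
    have := barMinus_mul_barPlus hPN g
    rw [hc, mul_one] at this
    rw [← this]
    exact plus_of_mem_minus hPN (barMinus_mem hPN g)
  · intro hc
    have := plus_mul_minus hPN g
    rw [hc, one_mul] at this
    rw [← this]
    exact barPlus_of_mem_minus hPN (minus_mem hPN g)

end Factorization

/-- The underlying vector space of the bicrossproduct Hopf algebra `H(G; P, N)` of a unique
factorization `G = P N`: the complex vector space with basis `G`. -/
def BicrossedHopf {G : Type*} [Group G] {P N : Subgroup G} (_ : P.IsComplement' N) : Type _ :=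
  G →₀ ℂ

namespace BicrossedHopf

variable {G : Type*} [Group G] {P N : Subgroup G} (hPN : P.IsComplement' N)

noncomputable instance : AddCommGroup (BicrossedHopf hPN) := inferInstanceAs (AddCommGroup (G →₀ ℂ))

noncomputable instance : Module ℂ (BicrossedHopf hPN) := inferInstanceAs (Module ℂ (G →₀ ℂ))

/-- The basis of `H(G; P, N)` given by the elements of `G`. -/
noncomputable def basis : Module.Basis G ℂ (BicrossedHopf hPN) :=
  Module.Basis.ofRepr (LinearEquiv.refl ℂ (G →₀ ℂ))

/-- The basis element `{g}`. -/
noncomputable def of (g : G) : BicrossedHopf hPN := basis hPN g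

open Classical in
/-- The bilinear multiplication `{g} {h} = δ_{ḡ₊, h₊} {g h₋}`; here `ḡ₊ = (g₊) ^ (g₋)`. -/
noncomputable def mulLin :
    BicrossedHopf hPN →ₗ[ℂ] BicrossedHopf hPN →ₗ[ℂ] BicrossedHopf hPN :=
  (basis hPN).constr ℂ fun g => (basis hPN).constr ℂ fun h =>
    if barPlus hPN g = plus hPN h then of hPN (g * minus hPN h) else 0

open Classical in
lemma mulLin_of (g h : G) : mulLin hPN (of hPN g) (of hPN h) =
    if barPlus hPN g = plus hPN h then of hPN (g * minus hPN h) else 0 := by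
  simp [mulLin, of]

lemma mulLin_assoc (a b c : BicrossedHopf hPN) :
    mulLin hPN (mulLin hPN a b) c = mulLin hPN a (mulLin hPN b c) := by
  have : (mulLin hPN).compr₂ (mulLin hPN) =
      (LinearMap.llcomp ℂ _ _ _ ∘ₗ (mulLin hPN)).compl₂ (mulLin hPN) := by
    refine (basis hPN).ext fun g => (basis hPN).ext fun h => (basis hPN).ext fun k => ?_
    change mulLin hPN (mulLin hPN (of hPN g) (of hPN h)) (of hPN k) =
      mulLin hPN (of hPN g) (mulLin hPN (of hPN h) (of hPN k))
    classical
    rw [mulLin_of, mulLin_of]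
    by_cases h1 : barPlus hPN g = plus hPN h
    · have h2 : barPlus hPN (g * minus hPN h) = barPlus hPN h := by
        rw [← barPlus_barPlus_mul, h1, plus_mul_minus]
      by_cases h3 : barPlus hPN h = plus hPN k
      · simp [h1, h2, h3, mulLin_of, plus_mul_of_mem, minus_mul_of_mem, minus_mem, mul_assoc]
      · simp [h1, h2, h3, mulLin_of]
    · by_cases h3 : barPlus hPN h = plus hPN k
      · simp [h1, h3, mulLin_of, plus_mul_of_mem, minus_mem]
      · simp [h1, h3]
  exact congr($this a b c)

section Fintype

variable [Fintype G]

open Classical in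
noncomputable instance : One (BicrossedHopf hPN) := ⟨∑ u : P, of hPN u⟩

open Classical in
lemma one_def : (1 : BicrossedHopf hPN) = ∑ u : P, of hPN u := rfl

lemma one_mulLin (a : BicrossedHopf hPN) : mulLin hPN 1 a = a := by
  have : mulLin hPN 1 = LinearMap.id := by
    refine (basis hPN).ext fun g => ?_
    change mulLin hPN 1 (of hPN g) = of hPN g
    classical
    rw [one_def, map_sum, LinearMap.sum_apply,
      Finset.sum_eq_single (⟨plus hPN g, plus_mem hPN g⟩ : P)]
    · simp [mulLin_of, barPlus_of_mem hPN (plus_mem hPN g), plus_mul_minus]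
    · intro u _ hu
      rw [mulLin_of, barPlus_of_mem hPN u.2, if_neg]
      exact fun h => hu (Subtype.ext h)
    · simp
  exact congr($this a)

lemma mulLin_one (a : BicrossedHopf hPN) : mulLin hPN a 1 = a := by
  have : (mulLin hPN).flip 1 = LinearMap.id := by
    refine (basis hPN).ext fun g => ?_
    change mulLin hPN (of hPN g) 1 = of hPN g
    classical
    rw [one_def, map_sum, Finset.sum_eq_single (⟨barPlus hPN g, barPlus_mem hPN g⟩ : P)]
    · simp [mulLin_of, plus_of_mem hPN (barPlus_mem hPN g), minus_of_mem hPN (barPlus_mem hPN g)]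
    · intro u _ hu
      rw [mulLin_of, plus_of_mem hPN u.2, if_neg]
      exact fun h => hu (Subtype.ext h.symm)
    · simp
  exact congr($this a)

noncomputable instance : Ring (BicrossedHopf hPN) where
  __ := (inferInstance : AddCommGroup (BicrossedHopf hPN))
  __ := (inferInstance : One (BicrossedHopf hPN))
  mul a b := mulLin hPN a b
  left_distrib a b c := map_add (mulLin hPN a) b c
  right_distrib a b c := LinearMap.map_add₂ (mulLin hPN) a b c
  zero_mul a := LinearMap.map_zero₂ (mulLin hPN) a
  mul_zero a := map_zero (mulLin hPN a)
  mul_assoc := mulLin_assoc hPN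
  one_mul := one_mulLin hPN
  mul_one := mulLin_one hPN

lemma mul_def (a b : BicrossedHopf hPN) : a * b = mulLin hPN a b := rfl

noncomputable instance : Algebra ℂ (BicrossedHopf hPN) :=
  Algebra.ofModule (fun r a b => LinearMap.map_smul₂ (mulLin hPN) r a b)
    (fun r a b => map_smul (mulLin hPN a) r b)

open Classical in
lemma of_mul_of (g h : G) : of hPN g * of hPN h =
    if barPlus hPN g = plus hPN h then of hPN (g * minus hPN h) else 0 :=
  mulLin_of hPN g h

open Classical in
/-- The comultiplication `Δ{g} = ∑_{h ∈ P} {g₊ h⁻¹ (ʰg₋)} ⊗ {h g₋}` and the counit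
`ε{g} = δ_{g₊, e}`; here `ʰg₋` is the component in `N` of `h g₋` for the factorization
`G = N P`. -/
noncomputable instance : CoalgebraStruct ℂ (BicrossedHopf hPN) where
  comul := (basis hPN).constr ℂ fun g => ∑ h : P,
    of hPN (plus hPN g * (h : G)⁻¹ * barMinus hPN (h * minus hPN g)) ⊗ₜ[ℂ]
      of hPN (h * minus hPN g)
  counit := (basis hPN).constr ℂ fun g => if plus hPN g = 1 then 1 else 0

open Classical in
lemma comul_of (g : G) : Coalgebra.comul (R := ℂ) (of hPN g) = ∑ h : P,
    of hPN (g * (barPlus hPN (h * minus hPN g))⁻¹) ⊗ₜ[ℂ] of hPN (h * minus hPN g) := by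
  simp only [← plus_mul_inv_mul_barMinus]
  exact (basis hPN).constr_basis ℂ _ g

open Classical in
lemma counit_of (g : G) : Coalgebra.counit (R := ℂ) (of hPN g) =
    if plus hPN g = 1 then 1 else 0 :=
  (basis hPN).constr_basis ℂ _ g

noncomputable instance : Coalgebra ℂ (BicrossedHopf hPN) where
  coassoc := by
    refine (basis hPN).ext fun g => ?_
    change (TensorProduct.assoc ℂ _ _ _) (Coalgebra.comul.rTensor _
      (Coalgebra.comul (of hPN g))) = Coalgebra.comul.lTensor _ (Coalgebra.comul (of hPN g))
    classical
    simp only [comul_of, map_sum, LinearMap.rTensor_tmul, LinearMap.lTensor_tmul,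
      TensorProduct.sum_tmul, TensorProduct.tmul_sum, TensorProduct.assoc_tmul]
    conv_rhs => rw [Finset.sum_comm]
    refine Finset.sum_congr rfl fun h _ => ?_
    refine Fintype.sum_equiv (Equiv.mulRight h) _ _ fun k => ?_
    have e1 : k * minus hPN (g * (barPlus hPN (h * minus hPN g))⁻¹) =
        k * h * minus hPN g * (barPlus hPN (h * minus hPN g))⁻¹ := by
      rw [minus_mul_barPlus_inv hPN g h h.2]
      group
    have e2 : minus hPN (k * h * minus hPN g) = minus hPN g := by
      rw [minus_of_mem_mul hPN (P.mul_mem k.2 h.2), minus_of_mem_minus hPN (minus_mem hPN g)]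
    simp only [e1, e2, Equiv.coe_mulRight,
      barPlus_mul_of_mem hPN _ (P.inv_mem (barPlus_mem hPN _)), Subgroup.coe_mul]
    congr 2
    group
  rTensor_counit_comp_comul := by
    refine (basis hPN).ext fun g => ?_
    change Coalgebra.counit.rTensor _ (Coalgebra.comul (of hPN g)) = 1 ⊗ₜ[ℂ] of hPN g
    classical
    simp only [comul_of, map_sum, LinearMap.rTensor_tmul, counit_of]
    rw [Finset.sum_eq_single (⟨plus hPN g, plus_mem hPN g⟩ : P)]
    · rw [plus_mul_barPlus_inv hPN _ _ (plus_mem hPN g)]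
      simp [plus_mul_minus]
    · intro u _ hu
      rw [plus_mul_barPlus_inv hPN _ _ u.2, if_neg, TensorProduct.zero_tmul]
      exact fun h => hu (Subtype.ext (mul_inv_eq_one.mp h).symm)
    · simp
  lTensor_counit_comp_comul := by
    refine (basis hPN).ext fun g => ?_
    change Coalgebra.counit.lTensor _ (Coalgebra.comul (of hPN g)) = of hPN g ⊗ₜ[ℂ] 1
    classical
    simp only [comul_of, map_sum, LinearMap.lTensor_tmul, counit_of]
    rw [Finset.sum_eq_single (1 : P)]
    · simp [plus_of_mem_minus hPN (minus_mem hPN g), barPlus_of_mem_minus hPN (minus_mem hPN g)]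
    · intro u _ hu
      rw [plus_mul_of_mem hPN _ (minus_mem hPN g), plus_of_mem hPN u.2, if_neg,
        TensorProduct.tmul_zero]
      exact fun h => hu (Subtype.ext h)
    · simp

noncomputable instance : Bialgebra ℂ (BicrossedHopf hPN) where
  counit_one := by
    classical
    simp only [one_def, map_sum, counit_of]
    rw [Finset.sum_eq_single (1 : P)]
    · simp [plus_one]
    · intro u _ hu
      rw [plus_of_mem hPN u.2, if_neg]
      exact fun h => hu (Subtype.ext h)
    · simp
  mul_compr₂_counit := by
    refine (basis hPN).ext fun g => (basis hPN).ext fun k => ?_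
    change Coalgebra.counit (of hPN g * of hPN k) =
      Coalgebra.counit (R := ℂ) (of hPN g) * Coalgebra.counit (R := ℂ) (of hPN k)
    classical
    rw [of_mul_of, apply_ite Coalgebra.counit, map_zero, counit_of, counit_of, counit_of,
      plus_mul_of_mem hPN _ (minus_mem hPN k)]
    by_cases h1 : plus hPN g = 1
    · simp [h1, (barPlus_eq_one_iff hPN g).2 h1, eq_comm]
    · simp [h1]
  comul_one := by
    classical
    simp only [one_def, map_sum, comul_of, Algebra.TensorProduct.one_def, TensorProduct.sum_tmul,
      TensorProduct.tmul_sum]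
    rw [Finset.sum_comm]
    refine Finset.sum_congr rfl fun h _ => ?_
    refine Fintype.sum_equiv (Equiv.mulRight h⁻¹) _ _ fun u => ?_
    simp [minus_of_mem hPN u.2, barPlus_of_mem hPN h.2]
  mul_compr₂_comul := by
    refine (basis hPN).ext fun g => (basis hPN).ext fun k => ?_
    change Coalgebra.comul (of hPN g * of hPN k) =
      Coalgebra.comul (R := ℂ) (of hPN g) * Coalgebra.comul (R := ℂ) (of hPN k)
    classical
    have hn := minus_mem hPN
    rw [of_mul_of, apply_ite Coalgebra.comul, map_zero, comul_of, comul_of, comul_of,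
      Finset.sum_mul_sum]
    have key (h : P) : (∑ l : P,
        (of hPN (g * (barPlus hPN (h * minus hPN g))⁻¹) ⊗ₜ[ℂ] of hPN (h * minus hPN g)) *
          (of hPN (k * (barPlus hPN (l * minus hPN k))⁻¹) ⊗ₜ[ℂ] of hPN (l * minus hPN k))) =
        if barPlus hPN g = plus hPN k then
          of hPN (g * minus hPN k * (barPlus hPN (h * minus hPN (g * minus hPN k)))⁻¹) ⊗ₜ[ℂ]
            of hPN (h * minus hPN (g * minus hPN k)) else 0 := by
      rw [Finset.sum_eq_single
        (⟨barPlus hPN (h * minus hPN g), barPlus_mem hPN _⟩ : P)]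
      · rw [Algebra.TensorProduct.tmul_mul_tmul, of_mul_of, of_mul_of,
          barPlus_mul_of_mem hPN _ (P.inv_mem (barPlus_mem hPN _)),
          plus_mul_barPlus_inv hPN _ _ (barPlus_mem hPN _), mul_left_inj,
          plus_mul_of_mem hPN _ (hn k), plus_of_mem hPN (barPlus_mem hPN _), if_pos rfl,
          minus_mul_barPlus_inv hPN _ _ (barPlus_mem hPN _), barPlus_barPlus_mul,
          minus_of_mem_mul hPN (barPlus_mem hPN _), minus_of_mem_minus hPN (hn k),
          minus_mul_of_mem hPN _ (hn k), TensorProduct.ite_tmul]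
        refine if_congr Iff.rfl ?_ rfl
        congr 2
        · group
        · group
      · intro l _ hl
        rw [Algebra.TensorProduct.tmul_mul_tmul, of_mul_of hPN (h * minus hPN g),
          plus_mul_of_mem hPN _ (hn k), plus_of_mem hPN l.2, if_neg, TensorProduct.tmul_zero]
        exact fun e => hl (Subtype.ext e.symm)
      · simp
    rw [Finset.sum_congr rfl fun h _ => key h]
    split_ifs
    · rfl
    · simp

/-- The antipode `S{g} = {g⁻¹}`. -/
noncomputable instance : HopfAlgebraStruct ℂ (BicrossedHopf hPN) where
  antipode := (basis hPN).constr ℂ fun g => of hPN g⁻¹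

lemma antipode_of (g : G) : HopfAlgebra.antipode ℂ (of hPN g) = of hPN g⁻¹ :=
  (basis hPN).constr_basis ℂ _ g

noncomputable instance : HopfAlgebra ℂ (BicrossedHopf hPN) where
  mul_antipode_rTensor_comul := by
    refine (basis hPN).ext fun g => ?_
    change LinearMap.mul' ℂ _ ((HopfAlgebra.antipode ℂ).rTensor _ (Coalgebra.comul (of hPN g))) =
      algebraMap ℂ _ (Coalgebra.counit (of hPN g))
    classical
    simp only [comul_of, map_sum, LinearMap.rTensor_tmul, LinearMap.mul'_apply, antipode_of,
      counit_of, of_mul_of]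
    have e1 (h : P) : barPlus hPN (g * (barPlus hPN (h * minus hPN g))⁻¹)⁻¹ =
        h * (plus hPN g)⁻¹ := by
      rw [barPlus, inv_inv, plus_mul_barPlus_inv hPN g h h.2, mul_inv_rev, inv_inv]
    have e2 (h : P) : plus hPN (h * minus hPN g) = h := by
      rw [plus_mul_of_mem hPN _ (minus_mem hPN g), plus_of_mem hPN h.2]
    have e3 (h : P) : minus hPN (h * minus hPN g) = minus hPN g := by
      rw [minus_of_mem_mul hPN h.2, minus_of_mem_minus hPN (minus_mem hPN g)]
    simp only [e1, e2, e3, mul_eq_left, inv_eq_one]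
    by_cases hg : plus hPN g = 1
    · have hg' : minus hPN g = g := by simpa [hg] using plus_mul_minus hPN g
      simp only [hg, if_true, hg', map_one, one_def]
      have hinj : Function.Injective fun h : P =>
          (⟨barPlus hPN (h * g), barPlus_mem hPN _⟩ : P) := by
        intro h h' e
        have e' : barPlus hPN (h * g) = barPlus hPN (h' * g) := congrArg Subtype.val e
        have e'' : barPlus hPN (barPlus hPN (h * g) * g⁻¹) =
            barPlus hPN (barPlus hPN (h' * g) * g⁻¹) := by rw [e']
        rw [barPlus_barPlus_mul, barPlus_barPlus_mul, mul_inv_cancel_right, mul_inv_cancel_right,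
          barPlus_of_mem hPN h.2, barPlus_of_mem hPN h'.2] at e''
        exact Subtype.ext e''
      refine Fintype.sum_bijective _ (Finite.injective_iff_bijective.mp hinj) _ _ fun h => ?_
      congr 1
      group
    · simp [hg]
  mul_antipode_lTensor_comul := by
    refine (basis hPN).ext fun g => ?_
    change LinearMap.mul' ℂ _ ((HopfAlgebra.antipode ℂ).lTensor _ (Coalgebra.comul (of hPN g))) =
      algebraMap ℂ _ (Coalgebra.counit (of hPN g))
    classical
    simp only [comul_of, map_sum, LinearMap.lTensor_tmul, LinearMap.mul'_apply, antipode_of,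
      counit_of, of_mul_of]
    have e1 (h : P) : plus hPN (h * minus hPN g)⁻¹ = (barPlus hPN (h * minus hPN g))⁻¹ := by
      rw [barPlus, inv_inv]
    have e2 (h : P) : minus hPN (h * minus hPN g)⁻¹ =
        barPlus hPN (h * minus hPN g) * (h * minus hPN g)⁻¹ := by
      rw [minus_eq, e1, inv_inv]
    simp only [barPlus_mul_of_mem hPN _ (P.inv_mem (barPlus_mem hPN _)), e1, e2, mul_eq_right,
      barPlus_eq_one_iff]
    by_cases hg : plus hPN g = 1
    · have hg' : minus hPN g = g := by simpa [hg] using plus_mul_minus hPN g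
      simp only [hg, if_true, hg', map_one, one_def]
      refine Fintype.sum_equiv (Equiv.inv P) _ _ fun h => ?_
      simp
    · simp [hg]

end Fintype

end BicrossedHopf

section QuasiTriangular

variable {H : Type*} [Ring H] [HopfAlgebra ℂ H]

/-- `R ∈ H ⊗ H` is a quasi-triangular structure on the Hopf algebra `H`. -/
structure IsQuasiTriangular (R : H ⊗[ℂ] H) : Prop where
  isUnit : IsUnit R
  /-- `τΔ(a) = R Δ(a) R⁻¹`. -/
  comm_comul (a : H) :
    TensorProduct.comm ℂ H H (Coalgebra.comul a) * R = R * Coalgebra.comul a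
  /-- `(Δ ⊗ id) R = R₁₃ R₂₃` in `H ⊗ H ⊗ H`. -/
  comul_rTensor :
    TensorProduct.assoc ℂ H H H (Coalgebra.comul.rTensor H R) =
      (Algebra.TensorProduct.includeRight (R := ℂ) (A := H) (B := H)).toLinearMap.lTensor H R *
        (1 : H) ⊗ₜ[ℂ] R
  /-- `(id ⊗ Δ) R = R₁₃ R₁₂` in `H ⊗ H ⊗ H`. -/
  comul_lTensor :
    Coalgebra.comul.lTensor H R =
      (Algebra.TensorProduct.includeRight (R := ℂ) (A := H) (B := H)).toLinearMap.lTensor H R *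
        TensorProduct.assoc ℂ H H H (R ⊗ₜ[ℂ] (1 : H))
  /-- `(ε ⊗ id) R = 1`. -/
  counit_rTensor : TensorProduct.lid ℂ H (Coalgebra.counit.rTensor H R) = 1
  /-- `(id ⊗ ε) R = 1`. -/
  counit_lTensor : TensorProduct.rid ℂ H (Coalgebra.counit.lTensor H R) = 1

variable {ι : Type*}

/-- A basis of a Hopf algebra over `ℂ` is positive if all the structure constants (of the
multiplication, unit, comultiplication, counit and antipode) are non-negative real numbers.
(`0 ≤ z` for `z : ℂ` means that `z` is real and non-negative.) -/
structure IsPositiveBasis (b : Module.Basis ι ℂ H) : Prop where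
  mul_nonneg (i j k : ι) : 0 ≤ b.repr (b i * b j) k
  one_nonneg (k : ι) : 0 ≤ b.repr 1 k
  comul_nonneg (i j k : ι) : 0 ≤ (b.tensorProduct b).repr (Coalgebra.comul (b i)) (j, k)
  counit_nonneg (i : ι) : 0 ≤ Coalgebra.counit (R := ℂ) (b i)
  antipode_nonneg (i j : ι) : 0 ≤ b.repr (HopfAlgebra.antipode ℂ (b i)) j

/-- `R ∈ H ⊗ H` is positive with respect to a basis `b` of `H` if it has non-negative coefficients
in the basis `b ⊗ b` of `H ⊗ H`. -/
def IsPositive (b : Module.Basis ι ℂ H) (R : H ⊗[ℂ] H) : Prop :=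
  ∀ i j : ι, 0 ≤ (b.tensorProduct b).repr R (i, j)

variable {H' : Type*} [Ring H'] [HopfAlgebra ℂ H']

/-- A quasi-isomorphism `H' → H` of Hopf algebras: an isomorphism of algebras `φ` (compatible with
the counits), together with an invertible twist `T ∈ H ⊗ H` through which `φ` intertwines the
comultiplications, `T` being a counital 2-cocycle. -/
structure IsQuasiIso (φ : H' ≃ₐ[ℂ] H) (T : (H ⊗[ℂ] H)ˣ) : Prop where
  /-- `ε(φ(a)) = ε(a)`. -/
  counit_map (a : H') : Coalgebra.counit (R := ℂ) (φ a) = Coalgebra.counit (R := ℂ) a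
  /-- `(φ ⊗ φ) Δ(a) = T Δ(φ(a)) T⁻¹`. -/
  map_comul (a : H') :
    TensorProduct.map φ.toLinearMap φ.toLinearMap (Coalgebra.comul a) =
      (T : H ⊗[ℂ] H) * Coalgebra.comul (φ a) * (↑T⁻¹ : H ⊗[ℂ] H)
  /-- `(T ⊗ 1) (Δ ⊗ id) T = (1 ⊗ T) (id ⊗ Δ) T` in `H ⊗ H ⊗ H`. -/
  cocycle :
    TensorProduct.assoc ℂ H H H ((T : H ⊗[ℂ] H) ⊗ₜ[ℂ] (1 : H)) *
        TensorProduct.assoc ℂ H H H (Coalgebra.comul.rTensor H (T : H ⊗[ℂ] H)) =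
      (1 : H) ⊗ₜ[ℂ] (T : H ⊗[ℂ] H) * Coalgebra.comul.lTensor H (T : H ⊗[ℂ] H)
  /-- `(ε ⊗ id) T = 1`. -/
  counit_rTensor : TensorProduct.lid ℂ H (Coalgebra.counit.rTensor H (T : H ⊗[ℂ] H)) = 1
  /-- `(id ⊗ ε) T = 1`. -/
  counit_lTensor : TensorProduct.rid ℂ H (Coalgebra.counit.lTensor H (T : H ⊗[ℂ] H)) = 1

/-- The pairs `(H', R')` and `(H, R)` are quasi-isomorphic: there is a quasi-isomorphism
`(φ, T) : H' → H` of Hopf algebras with `(φ ⊗ φ) R' = τ(T) R T⁻¹`. -/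
def QuasiIsomorphic (R' : H' ⊗[ℂ] H') (R : H ⊗[ℂ] H) : Prop :=
  ∃ (φ : H' ≃ₐ[ℂ] H) (T : (H ⊗[ℂ] H)ˣ), IsQuasiIso φ T ∧
    TensorProduct.map φ.toLinearMap φ.toLinearMap R' =
      TensorProduct.comm ℂ H H (T : H ⊗[ℂ] H) * R * (↑T⁻¹ : H ⊗[ℂ] H)

end QuasiTriangular

section Normal

variable {G : Type*} [Group G] {P N : Subgroup G} (hPN : P.IsComplement' N)

/-- The conditions on a pair of homomorphisms `ξ, η : P → N` (for `G = P N`): the sets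
`P' = {u ξ(u⁻¹)}` and `P'' = {η(u⁻¹) u}` are normal subgroups of `G`, and
`F(u ξ(u⁻¹)) = η(u) u⁻¹` defines a group isomorphism `F : P' → P''`. -/
def IsAdmissible (ξ η : P →* N) : Prop :=
  ∃ P' P'' : Subgroup G,
    (P' : Set G) = Set.range (fun u : P => (u : G) * ξ u⁻¹) ∧
    (P'' : Set G) = Set.range (fun u : P => (η u⁻¹ : G) * u) ∧
    P'.Normal ∧ P''.Normal ∧
    ∃ F : P' ≃* P'', ∀ (u : P) (a : P'), (a : G) = u * ξ u⁻¹ → (F a : G) = η u * (u : G)⁻¹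

open Classical in
/-- The element `∑_{u, v ∈ P} {u (η(v)ᵘ)⁻¹} ⊗ {v ξ(u)}` of `H(G; P, N) ⊗ H(G; P, N)`; here `η(v)ᵘ`
is the component in `N` of `η(v) u` for the factorization `G = P N`. -/
noncomputable def rMatrix [Fintype G] (ξ η : P →* N) :
    BicrossedHopf hPN ⊗[ℂ] BicrossedHopf hPN :=
  ∑ u : P, ∑ v : P,
    BicrossedHopf.of hPN ((u : G) * (minus hPN (η v * u))⁻¹) ⊗ₜ[ℂ]
      BicrossedHopf.of hPN ((v : G) * ξ u)

/-- `R` is a normal positive quasi-triangular structure on `H(G; P, N)`: it is given by a pair of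
homomorphisms `ξ, η : P → N` with `ξ` trivial. -/
def IsNormal [Fintype G] (R : BicrossedHopf hPN ⊗[ℂ] BicrossedHopf hPN) : Prop :=
  IsQuasiTriangular R ∧ IsPositive (BicrossedHopf.basis hPN) R ∧
    ∃ ξ η : P →* N, IsAdmissible ξ η ∧ R = rMatrix hPN ξ η ∧ ∀ u : P, ξ u = 1

end Normal

end PositiveHopf

/-! Non-negative numbers do not cancel, so every axiom for the structure constants is also an axiom
for their supports, and the basis becomes a Hopf monoid in relations (`RelHopf`). There the
constituents of the unit form a group I, multiplied through the coproduct, and dually the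
constituents of the counit form a group J. The antipode makes every basis element invertible as an
arrow, so basis elements correspond to pairs in I × J (`arrow_ext`, `exists_arrow`), and the
supports are those of the bicrossproduct of a matched pair (I, J). The values of the constants form
a positive 2-cocycle on this pair; averaging logarithms makes it a coboundary
(`exists_trivialization`), so a positive rescaling of the basis turns H into a bicrossproduct
(`exists_isBicrossedBasis`).

Now H is the algebra of the action groupoid of J on I, with arrows e(u, x) from u to u ◁ x. The
inverse of R is (S ⊗ id)R, again non-negative, and a non-negative element with non-negative inverse
in a groupoid algebra has exactly one arrow at each source (`exists_arrowSum_of_mul_eq_one`). Its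
coefficients are 1 because finite groups have no non-trivial positive characters
(`eq_one_of_cocycle`). Hence R = ∑ e(u, A(u, v)) ⊗ e(v, ξ(u)), with the relations `IsBraiding`.

In the factorizable group G = J I, the maps ξ and η(v) = A(1, v)⁻¹ define two retractions of G onto
J, whose kernels are normal complements of J; the braid relation says that the kernels commute
elementwise (`commute_ker`). The twist T = ∑ e(u, ξ(v)⁻¹) ⊗ e(v, 1) keeps G and J but replaces I by
the kernel of the first retraction, and makes the J-labels in the second leg of R trivial. The
result is normal because the kernels commute (`isNormal_two`). -/

namespace PositiveHopf

/-! ### Hopf monoids in relations -/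

/-- A Hopf monoid in the category of sets and relations: `M i j k` says that `k` occurs in the
product of `i` and `j`, `D i j k` that `i ⊗ j` occurs in the coproduct of `k`, and `E`, `C`, `S`
describe the unit, the counit and the antipode. -/
structure RelHopf (ι : Type*) where
  M : ι → ι → ι → Prop
  D : ι → ι → ι → Prop
  E : ι → Prop
  C : ι → Prop
  S : ι → ι → Prop
  assoc (i j k l : ι) : (∃ p, M i j p ∧ M p k l) ↔ ∃ q, M j k q ∧ M i q l
  coassoc (i j k l : ι) : (∃ p, D i j p ∧ D p k l) ↔ ∃ q, D j k q ∧ D i q l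
  one_left (i j : ι) : (∃ e, E e ∧ M e i j) ↔ i = j
  one_right (i j : ι) : (∃ e, E e ∧ M i e j) ↔ i = j
  counit_left (i j : ι) : (∃ c, C c ∧ D c i j) ↔ i = j
  counit_right (i j : ι) : (∃ c, C c ∧ D i c j) ↔ i = j
  mul_comul (i j k l : ι) : (∃ p, M i j p ∧ D k l p) ↔
    ∃ a b c d, D a b i ∧ D c d j ∧ M a c k ∧ M b d l
  comul_one (i j : ι) : (∃ e, E e ∧ D i j e) ↔ E i ∧ E j
  counit_mul (i j : ι) : (∃ c, C c ∧ M i j c) ↔ C i ∧ C j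
  counit_one : ∃ e, E e ∧ C e
  antipode_left (k l : ι) : (∃ i j i', D i j k ∧ S i i' ∧ M i' j l) ↔ C k ∧ E l
  antipode_right (k l : ι) : (∃ i j j', D i j k ∧ S j j' ∧ M i j' l) ↔ C k ∧ E l

namespace RelHopf

variable {ι : Type*} (h : RelHopf ι)

/-- The dual Hopf monoid in relations. -/
def dual : RelHopf ι where
  M := h.D
  D := h.M
  E := h.C
  C := h.E
  S i j := h.S j i
  assoc := h.coassoc
  coassoc := h.assoc
  one_left := h.counit_left
  one_right := h.counit_right
  counit_left := h.one_left
  counit_right := h.one_right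
  -- The bialgebra axiom is self-dual up to exchanging the two middle elements.
  mul_comul i j k l := by
    have := h.mul_comul k l i j
    constructor
    · rintro ⟨p, h1, h2⟩
      obtain ⟨a, b, c, d, h3, h4, h5, h6⟩ := this.1 ⟨p, h2, h1⟩
      exact ⟨a, c, b, d, h5, h6, h3, h4⟩
    · rintro ⟨a, b, c, d, h3, h4, h5, h6⟩
      obtain ⟨p, h1, h2⟩ := this.2 ⟨a, c, b, d, h5, h6, h3, h4⟩
      exact ⟨p, h2, h1⟩
  comul_one := h.counit_mul
  counit_mul := h.comul_one
  counit_one := h.counit_one.imp fun _ => And.symm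
  antipode_left k l := by
    rw [and_comm, ← h.antipode_left l k]
    constructor
    · rintro ⟨i, j, i', h1, h2, h3⟩
      exact ⟨i', j, i, h3, h2, h1⟩
    · rintro ⟨i, j, i', h1, h2, h3⟩
      exact ⟨i', j, i, h3, h2, h1⟩
  antipode_right k l := by
    rw [and_comm, ← h.antipode_right l k]
    constructor
    · rintro ⟨i, j, i', h1, h2, h3⟩
      exact ⟨i, i', j, h3, h2, h1⟩
    · rintro ⟨i, j, i', h1, h2, h3⟩
      exact ⟨i, i', j, h3, h2, h1⟩

/-- The constituents of the unit. -/
def I : Type _ := {i // h.E i}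

instance : CoeOut h.I ι := ⟨Subtype.val⟩

variable {h}

lemma I_ext {i j : h.I} (hij : (i : ι) = j) : i = j := Subtype.ext hij

lemma eq_of_left {e i j : ι} (he : h.E e) (hm : h.M e i j) : i = j := (h.one_left i j).1 ⟨e, he, hm⟩

lemma eq_of_right {e i j : ι} (he : h.E e) (hm : h.M i e j) : i = j :=
  (h.one_right i j).1 ⟨e, he, hm⟩

variable (h) in
/-- The unit constituent acting trivially on the left of `b`. -/
noncomputable def src (b : ι) : h.I :=
  ⟨((h.one_left b b).2 rfl).choose, ((h.one_left b b).2 rfl).choose_spec.1⟩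

variable (h) in
/-- The unit constituent acting trivially on the right of `b`. -/
noncomputable def tgt (b : ι) : h.I :=
  ⟨((h.one_right b b).2 rfl).choose, ((h.one_right b b).2 rfl).choose_spec.1⟩

lemma src_spec (b : ι) : h.M (h.src b) b b := ((h.one_left b b).2 rfl).choose_spec.2

lemma tgt_spec (b : ι) : h.M b (h.tgt b) b := ((h.one_right b b).2 rfl).choose_spec.2

/-- Comparing with `src_spec` through associativity gives a non-empty product of two unit
constituents, and such constituents must coincide. Hence the choice made in `src` does not matter.
-/
lemma src_eq {e i j : ι} (he : h.E e) (hm : h.M e i j) : (h.src i : ι) = e := by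
  obtain rfl := eq_of_left he hm
  obtain ⟨p, h1, -⟩ := (h.assoc _ _ _ _).2 ⟨i, src_spec (h := h) i, hm⟩
  exact (eq_of_left he h1).trans (eq_of_right (h.src i).2 h1).symm

lemma tgt_eq {e i j : ι} (he : h.E e) (hm : h.M i e j) : (h.tgt i : ι) = e := by
  obtain rfl := eq_of_right he hm
  obtain ⟨p, h1, -⟩ := (h.assoc _ _ _ _).1 ⟨i, tgt_spec (h := h) i, hm⟩
  exact (eq_of_right he h1).trans (eq_of_left (h.tgt i).2 h1).symm

lemma src_mul {a b c : ι} (hm : h.M a b c) : h.src c = h.src a := by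
  obtain ⟨q, h1, h2⟩ := (h.assoc _ _ _ _).1 ⟨a, src_spec (h := h) a, hm⟩
  obtain rfl := eq_of_left (h.src a).2 h2
  exact I_ext (src_eq (h.src a).2 h2)

lemma tgt_mul {a b c : ι} (hm : h.M a b c) : h.tgt c = h.tgt b := by
  obtain ⟨q, h1, h2⟩ := (h.assoc _ _ _ _).2 ⟨b, tgt_spec (h := h) b, hm⟩
  obtain rfl := eq_of_right (h.tgt b).2 h2
  exact I_ext (tgt_eq (h.tgt b).2 h2)

lemma tgt_eq_src {a b c : ι} (hm : h.M a b c) : h.tgt a = h.src b := by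
  obtain ⟨q, h1, h2⟩ := (h.assoc _ _ _ _).1 ⟨a, tgt_spec (h := h) a, hm⟩
  exact (I_ext (src_eq (h.tgt a).2 h1)).symm

lemma src_coe (i : h.I) : h.src i = i := I_ext (eq_of_right i.2 (src_spec (h := h) i) : _)

lemma tgt_coe (i : h.I) : h.tgt i = i := I_ext (eq_of_left i.2 (tgt_spec (h := h) i) : _)

lemma mul_self_coe (i : h.I) : h.M i i i := by
  simpa only [src_coe] using src_spec (h := h) i

lemma eq_of_E_of_C {c d : ι} (h1 : h.E c) (h2 : h.C c) (h3 : h.E d) (h4 : h.C d) : c = d := by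
  obtain ⟨k, -, h5⟩ := (h.counit_mul _ _).2 ⟨h2, h4⟩
  exact (eq_of_right h3 h5).trans (eq_of_left h1 h5).symm

/-- Unit constituents are idempotent, so `i ⊗ j` times itself is non-empty and occurs in the
coproduct of something in `k * k'`; distinct unit constituents have empty product. -/
lemma eq_of_comul {i j k k' : ι} (hi : h.E i) (hj : h.E j) (hk : h.E k) (hk' : h.E k')
    (h1 : h.D i j k) (h2 : h.D i j k') : k = k' := by
  obtain ⟨p, h3, -⟩ := (h.mul_comul k k' i j).2
    ⟨i, j, i, j, h1, h2, mul_self_coe (h := h) ⟨i, hi⟩, mul_self_coe (h := h) ⟨j, hj⟩⟩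
  exact (eq_of_right hk' h3).trans (eq_of_left hk h3).symm

/-- The product of `i` and `j` is the unit constituent whose coproduct contains `i ⊗ j`; it exists
because Δ(1) = 1 ⊗ 1. -/
noncomputable instance : Mul h.I := ⟨fun i j =>
  ⟨((h.comul_one i j).2 ⟨i.2, j.2⟩).choose, ((h.comul_one i j).2 ⟨i.2, j.2⟩).choose_spec.1⟩⟩

noncomputable instance : One h.I := ⟨⟨h.counit_one.choose, h.counit_one.choose_spec.1⟩⟩

lemma comul_mul (i j : h.I) : h.D i j (i * j : h.I) :=
  ((h.comul_one i j).2 ⟨i.2, j.2⟩).choose_spec.2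

lemma eq_mul {i j k : h.I} (hd : h.D i j k) : k = i * j :=
  I_ext (eq_of_comul i.2 j.2 k.2 (i * j).2 hd (comul_mul i j))

lemma C_one : h.C (1 : h.I) := h.counit_one.choose_spec.2

lemma eq_one_of_C {i : h.I} (hi : h.C i) : i = 1 :=
  I_ext (eq_of_E_of_C i.2 hi (1 : h.I).2 C_one)

/-- The antipode axiom for the pair `(1, l)` supplies a term of the coproduct of `1` whose second
factor must be `l`; its first factor is the inverse. -/
lemma exists_inv_mul (l : h.I) : ∃ i : h.I, i * l = 1 := by
  obtain ⟨i, j, i', h1, -, h3⟩ := (h.antipode_left (1 : h.I) l).2 ⟨C_one, l.2⟩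
  obtain ⟨hi, hj⟩ := (h.comul_one i j).1 ⟨_, (1 : h.I).2, h1⟩
  obtain rfl := eq_of_right hj h3
  obtain rfl := eq_of_left l.2 h3
  exact ⟨⟨i, hi⟩, (eq_mul (i := ⟨i, hi⟩) h1).symm⟩

noncomputable instance : Inv h.I := ⟨fun l => (exists_inv_mul l).choose⟩

noncomputable instance : Group h.I := Group.ofLeftAxioms
  (fun i j k => by
    obtain ⟨q, h1, h2⟩ := (h.coassoc _ _ _ _).1 ⟨_, comul_mul i j, comul_mul (i * j) k⟩
    obtain ⟨q, rfl⟩ : ∃ q' : h.I, (q' : ι) = q :=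
      ⟨⟨q, ((h.comul_one i q).1 ⟨_, (i * j * k).2, h2⟩).2⟩, rfl⟩
    rw [← eq_mul h1]
    exact eq_mul h2)
  (fun i => by
    obtain ⟨c, hc, h1⟩ := (h.counit_left (i : ι) i).2 rfl
    obtain ⟨c, rfl⟩ : ∃ c' : h.I, (c' : ι) = c :=
      ⟨⟨c, ((h.comul_one c i).1 ⟨_, i.2, h1⟩).1⟩, rfl⟩
    rw [← eq_one_of_C hc]
    exact (eq_mul h1).symm)
  (fun i => (exists_inv_mul i).choose_spec)

lemma src_eq_one {b : ι} (hb : h.C b) : h.src b = 1 :=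
  eq_one_of_C ((h.counit_mul _ _).1 ⟨b, hb, src_spec b⟩).1

lemma tgt_eq_one {b : ι} (hb : h.C b) : h.tgt b = 1 :=
  eq_one_of_C ((h.counit_mul _ _).1 ⟨b, hb, tgt_spec b⟩).2

/-- Multiplicativity of Δ on the product of `src c` and `c` writes `a` and `b` as left multiples by
the two factors of a term of Δ(`src c`), which are then the sources of `a` and `b`. -/
lemma src_comul {a b c : ι} (hd : h.D a b c) : h.src c = h.src a * h.src b := by
  obtain ⟨a1, b1, c1, d1, h1, h2, h3, h4⟩ := (h.mul_comul _ _ _ _).1 ⟨c, src_spec c, hd⟩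
  obtain ⟨ha, hb⟩ := (h.comul_one _ _).1 ⟨_, (h.src c).2, h1⟩
  obtain rfl := eq_of_left ha h3
  obtain rfl := eq_of_left hb h4
  rw [← src_eq ha h3, ← src_eq hb h4] at h1
  exact eq_mul h1

lemma tgt_comul {a b c : ι} (hd : h.D a b c) : h.tgt c = h.tgt a * h.tgt b := by
  obtain ⟨a1, b1, c1, d1, h1, h2, h3, h4⟩ := (h.mul_comul _ _ _ _).1 ⟨c, tgt_spec c, hd⟩
  obtain ⟨ha, hb⟩ := (h.comul_one _ _).1 ⟨_, (h.tgt c).2, h2⟩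
  obtain rfl := eq_of_right ha h3
  obtain rfl := eq_of_right hb h4
  rw [← tgt_eq ha h3, ← tgt_eq hb h4] at h2
  exact eq_mul h2

/-- A term `i ⊗ j` of Δ(x) that contributes the unit constituent `1` has `i` in the counit;
counitality then forces `i = j = x`. -/
lemma exists_antipode_right {x : ι} (hx : h.C x) : ∃ y, h.S x y ∧ h.M x y (1 : h.I) := by
  obtain ⟨i, j, y, h1, h2, h3⟩ := (h.antipode_right x (1 : h.I)).2 ⟨hx, (1 : h.I).2⟩
  obtain ⟨hi, -⟩ := (h.counit_mul _ _).1 ⟨_, C_one, h3⟩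
  obtain rfl : j = x := eq_of_left (h := h.dual) hi h1
  obtain rfl : i = j := eq_of_right (h := h.dual) hx h1
  exact ⟨y, h2, h3⟩

lemma exists_antipode_left {x : ι} (hx : h.C x) : ∃ y, h.S x y ∧ h.M y x (1 : h.I) := by
  obtain ⟨i, j, y, h1, h2, h3⟩ := (h.antipode_left x (1 : h.I)).2 ⟨hx, (1 : h.I).2⟩
  obtain ⟨-, hj⟩ := (h.counit_mul _ _).1 ⟨_, C_one, h3⟩
  obtain rfl : i = x := eq_of_right (h := h.dual) hj h1
  obtain rfl : j = i := eq_of_left (h := h.dual) hx h1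
  exact ⟨y, h2, h3⟩

/-- With x the cotarget of b, the term b ⊗ x occurs in Δ(b). Since S(x) x contains `1` and b · 1 =
b, the product b S(x) is non-empty, so b lies in the support of id * S, which is the unit composed
with the counit. -/
lemma C_of_tgt_eq_one {b : ι} (hb : h.tgt b = 1) : h.C b := by
  obtain ⟨y, h1, h2⟩ := exists_antipode_left (h.dual.tgt b).2
  have h3 := tgt_spec (h := h) b
  rw [hb] at h3
  obtain ⟨p, h4, -⟩ := (h.assoc _ _ _ _).2 ⟨_, h2, h3⟩
  have h5 : h.D b (h.dual.tgt b) b := tgt_spec (h := h.dual) b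
  exact ((h.antipode_right b p).1 ⟨_, _, _, h5, h1, h4⟩).1

lemma C_of_src_eq_one {b : ι} (hb : h.src b = 1) : h.C b := by
  obtain ⟨y, h1, h2⟩ := exists_antipode_right (h.dual.src b).2
  have h3 := src_spec (h := h) b
  rw [hb] at h3
  obtain ⟨p, h4, -⟩ := (h.assoc _ _ _ _).1 ⟨_, h2, h3⟩
  have h5 : h.D (h.dual.src b) b b := src_spec (h := h.dual) b
  exact ((h.antipode_left b p).1 ⟨_, _, _, h5, h1, h4⟩).1

lemma E_of_cotgt_eq_one {b : ι} (hb : h.dual.tgt b = 1) : h.E b := C_of_tgt_eq_one (h := h.dual) hb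

lemma E_of_cosrc_eq_one {b : ι} (hb : h.dual.src b = 1) : h.E b := C_of_src_eq_one (h := h.dual) hb

lemma cosrc_mul {a b c : ι} (hm : h.M a b c) : h.dual.src c = h.dual.src a * h.dual.src b :=
  src_comul (h := h.dual) hm

lemma cotgt_mul {a b c : ι} (hm : h.M a b c) : h.dual.tgt c = h.dual.tgt a * h.dual.tgt b :=
  tgt_comul (h := h.dual) hm

lemma cosrc_coe (i : h.I) : h.dual.src i = 1 := src_eq_one (h := h.dual) i.2

lemma cotgt_coe (i : h.I) : h.dual.tgt i = 1 := tgt_eq_one (h := h.dual) i.2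

/-- The cosources of `b` and `b'` are inverse to each other, so the relevant constituent of `b' b`
has trivial cosource and is therefore a unit constituent. -/
lemma mul_tgt_of_mul {b b' : ι} {i : h.I} (hm : h.M b b' i) : h.M b' b (h.tgt b) := by
  have hs : h.src b = i := by rw [← src_mul hm, src_coe]
  have h1 := src_spec (h := h) b
  rw [hs] at h1
  obtain ⟨q, h2, h3⟩ := (h.assoc _ _ _ _).1 ⟨_, hm, h1⟩
  have h4 := (cosrc_mul hm).symm
  rw [cosrc_coe] at h4
  have h5 : h.dual.src q = 1 := by rw [cosrc_mul h2, eq_inv_of_mul_eq_one_left h4, mul_inv_cancel]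
  have hq : h.E q := E_of_cosrc_eq_one h5
  rwa [tgt_eq hq h3]

/-- Cancel `b`: a constituent `r` of `b' c` with `c ∈ b r` has trivial cosource or cotarget, hence
is a unit constituent. -/
lemma eq_of_src_of_inv {b b' c : ι} {i : h.I} (hm : h.M b b' i) (hs : h.src c = h.src b)
    (hc : h.dual.src c = h.dual.src b ∨ h.dual.tgt c = h.dual.tgt b) : c = b := by
  have h1 := src_spec (h := h) c
  have hs' : h.src b = i := by rw [← src_mul hm, src_coe]
  rw [hs, hs'] at h1
  obtain ⟨r, h2, h3⟩ := (h.assoc _ _ _ _).1 ⟨_, hm, h1⟩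
  have hr : h.E r := by
    rcases hc with hc | hc
    · have h4 := (cosrc_mul hm).symm
      rw [cosrc_coe] at h4
      refine E_of_cosrc_eq_one ?_
      rw [cosrc_mul h2, hc, eq_inv_of_mul_eq_one_left h4, mul_inv_cancel]
    · have h4 := (cotgt_mul hm).symm
      rw [cotgt_coe] at h4
      refine E_of_cotgt_eq_one ?_
      rw [cotgt_mul h2, hc, eq_inv_of_mul_eq_one_left h4, mul_inv_cancel]
  exact (eq_of_right hr h3).symm

/-- The antipode axiom for the cosource and the source of `b` produces an invertible element with
this source and cosource, which is `b` by `eq_of_src_of_inv`. -/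
lemma exists_inverse (b : ι) : ∃ b', h.M b b' (h.src b) := by
  obtain ⟨j, k, j', h1, -, h3⟩ := (h.antipode_right (h.dual.src b) (h.src b)).2
    ⟨(h.dual.src b).2, (h.src b).2⟩
  have hj : b = j := by
    refine eq_of_src_of_inv h3 ?_ (Or.inl ?_)
    · rw [← src_mul h3, src_coe]
    · rw [← src_mul (h := h.dual) h1, src_coe]
  exact ⟨j', hj ▸ h3⟩

lemma arrow_ext {b c : ι} (hs : h.src b = h.src c) (ht : h.dual.tgt b = h.dual.tgt c) : b = c := by
  obtain ⟨c', hc⟩ := exists_inverse (h := h) c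
  exact eq_of_src_of_inv hc hs (Or.inr ht)

lemma exists_arrow (i : h.I) (x : h.dual.I) : ∃ b, h.src b = i ∧ h.dual.tgt b = x := by
  -- The antipode axiom for `x⁻¹` and `i` gives `i ∈ j' k` with `k` of cotarget `x⁻¹`; since `i` has
  -- trivial cotarget, `j'` has cotarget `x`.
  obtain ⟨j, k, j', h1, -, h3⟩ := (h.antipode_left (x⁻¹ : h.dual.I) i).2 ⟨(x⁻¹).2, i.2⟩
  refine ⟨j', ?_, ?_⟩
  · rw [← src_mul h3, src_coe]
  · have h2 : h.dual.tgt k = x⁻¹ := by rw [← tgt_mul (h := h.dual) h1, tgt_coe]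
    have h4 := (cotgt_mul h3).symm
    rw [cotgt_coe, h2] at h4
    simpa using eq_inv_of_mul_eq_one_left h4

variable (h) in
/-- The element with given source and cotarget. -/
noncomputable def arrow (i : h.I) (x : h.dual.I) : ι := (exists_arrow i x).choose

lemma src_arrow (i : h.I) (x : h.dual.I) : h.src (h.arrow i x) = i :=
  (exists_arrow i x).choose_spec.1

lemma cotgt_arrow (i : h.I) (x : h.dual.I) : h.dual.tgt (h.arrow i x) = x :=
  (exists_arrow i x).choose_spec.2

lemma eq_arrow {b : ι} {i : h.I} {x : h.dual.I} (h1 : h.src b = i) (h2 : h.dual.tgt b = x) :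
    b = h.arrow i x :=
  arrow_ext (h1.trans (src_arrow i x).symm) (h2.trans (cotgt_arrow i x).symm)

variable (h) in
/-- The elements are parametrized by source and cotarget. -/
noncomputable def arrowEquiv : h.I × h.dual.I ≃ ι where
  toFun p := h.arrow p.1 p.2
  invFun b := (h.src b, h.dual.tgt b)
  left_inv p := by simp [src_arrow, cotgt_arrow]
  right_inv b := (eq_arrow rfl rfl).symm

/-- With `a'` inverse to `a`, the product `(a' a) b` contains `b`, so reassociating shows that `a b`
cannot be empty. -/
lemma exists_mul {a b : ι} (hab : h.tgt a = h.src b) : ∃ c, h.M a b c := by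
  obtain ⟨a', ha⟩ := exists_inverse (h := h) a
  have h1 := src_spec (h := h) b
  rw [← hab] at h1
  obtain ⟨r, h2, -⟩ := (h.assoc _ _ _ _).1 ⟨_, mul_tgt_of_mul ha, h1⟩
  exact ⟨r, h2⟩

lemma mul_iff {a b c : ι} : h.M a b c ↔
    h.tgt a = h.src b ∧ h.src c = h.src a ∧ h.dual.tgt c = h.dual.tgt a * h.dual.tgt b := by
  constructor
  · exact fun hm => ⟨tgt_eq_src hm, src_mul hm, cotgt_mul hm⟩
  · rintro ⟨h1, h2, h3⟩
    obtain ⟨d, hd⟩ := exists_mul h1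
    rwa [arrow_ext (b := c) (c := d) (h2.trans (src_mul hd).symm) (h3.trans (cotgt_mul hd).symm)]

lemma comul_iff {a b c : ι} : h.D a b c ↔
    h.dual.tgt a = h.dual.src b ∧ h.src c = h.src a * h.src b ∧
      h.dual.tgt c = h.dual.tgt b := by
  constructor
  · exact fun hm => ⟨tgt_eq_src (h := h.dual) hm, src_comul hm, tgt_mul (h := h.dual) hm⟩
  · rintro ⟨h1, h2, h3⟩
    obtain ⟨d, hd⟩ := exists_mul (h := h.dual) h1
    rwa [arrow_ext (b := c) (c := d) (h2.trans (src_comul hd).symm)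
      (h3.trans (tgt_mul (h := h.dual) hd).symm)]

end RelHopf

/-! ### The matched pair of a Hopf monoid in relations -/

/-- A matched pair of groups: mutual actions `i ◁ x = act i x` and `i ▷ x = co i x` with which
`i x = (i ▷ x) (i ◁ x)` defines a factorizable group. -/
structure MatchedPair (I J : Type*) [Group I] [Group J] where
  act : I → J → I
  co : I → J → J
  act_one (i : I) : act i 1 = i
  act_mul (i : I) (x y : J) : act i (x * y) = act (act i x) y
  one_act (x : J) : act 1 x = 1
  mul_act (i j : I) (x : J) : act (i * j) x = act i (co j x) * act j x
  one_co (x : J) : co 1 x = x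
  mul_co (i j : I) (x : J) : co (i * j) x = co i (co j x)
  co_one (i : I) : co i 1 = 1
  co_mul (i : I) (x y : J) : co i (x * y) = co i x * co (act i x) y

namespace RelHopf

variable {ι : Type*} {h : RelHopf ι}

lemma arrow_one (i : h.I) : h.arrow i 1 = i := (eq_arrow (src_coe i) (cotgt_coe i)).symm

lemma one_arrow (x : h.dual.I) : h.arrow 1 x = x :=
  (eq_arrow (src_eq_one x.2) (tgt_coe (h := h.dual) x)).symm

lemma mul_arrow (i : h.I) (x y : h.dual.I) :
    h.M (h.arrow i x) (h.arrow (h.tgt (h.arrow i x)) y) (h.arrow i (x * y)) := by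
  simp [mul_iff, src_arrow, cotgt_arrow]

lemma comul_arrow (i j : h.I) (x : h.dual.I) :
    h.D (h.arrow i (h.dual.src (h.arrow j x))) (h.arrow j x) (h.arrow (i * j) x) := by
  simp [comul_iff, src_arrow, cotgt_arrow]

variable (h) in
/-- The matched pair of groups of a Hopf monoid in relations. -/
noncomputable def matchedPair : MatchedPair h.I h.dual.I where
  act i x := h.tgt (h.arrow i x)
  co i x := h.dual.src (h.arrow i x)
  act_one i := by rw [arrow_one, tgt_coe]
  act_mul i x y := tgt_mul (mul_arrow i x y)
  one_act x := by rw [one_arrow]; exact tgt_eq_one x.2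
  mul_act i j x := tgt_comul (comul_arrow i j x)
  one_co x := by rw [one_arrow]; exact src_coe (h := h.dual) x
  mul_co i j x := src_mul (h := h.dual) (comul_arrow i j x)
  co_one i := by rw [arrow_one, cosrc_coe]
  co_mul i x y := cosrc_mul (mul_arrow i x y)

end RelHopf

/-! ### Non-negative structure constants and their supports -/

/-- Non-negative structure constants of a Hopf algebra: `m i j k` is the coefficient of `k` in
`i * j`, `d i j k` that of `i ⊗ j` in the coproduct of `k`, and `u`, `c`, `s` describe the unit,
the counit and the antipode. -/
structure NonnegHopf (ι : Type*) [Fintype ι] [DecidableEq ι] where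
  m : ι → ι → ι → ℝ
  d : ι → ι → ι → ℝ
  u : ι → ℝ
  c : ι → ℝ
  s : ι → ι → ℝ
  m_nonneg (i j k : ι) : 0 ≤ m i j k
  d_nonneg (i j k : ι) : 0 ≤ d i j k
  u_nonneg (i : ι) : 0 ≤ u i
  c_nonneg (i : ι) : 0 ≤ c i
  s_nonneg (i j : ι) : 0 ≤ s i j
  assoc (i j k l : ι) : ∑ p, m i j p * m p k l = ∑ q, m j k q * m i q l
  coassoc (i j k l : ι) : ∑ p, d i j p * d p k l = ∑ q, d j k q * d i q l
  one_left (i j : ι) : ∑ e, u e * m e i j = if i = j then 1 else 0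
  one_right (i j : ι) : ∑ e, u e * m i e j = if i = j then 1 else 0
  counit_left (i j : ι) : ∑ e, c e * d e i j = if i = j then 1 else 0
  counit_right (i j : ι) : ∑ e, c e * d i e j = if i = j then 1 else 0
  mul_comul (i j k l : ι) : ∑ p, m i j p * d k l p =
    ∑ p, ∑ q, ∑ p', ∑ q', d p q i * d p' q' j * (m p p' k * m q q' l)
  comul_one (i j : ι) : ∑ p, u p * d i j p = u i * u j
  counit_mul (i j : ι) : ∑ p, c p * m i j p = c i * c j
  counit_one : ∑ p, u p * c p = 1
  antipode_left (k l : ι) : ∑ i, ∑ j, ∑ i', d i j k * (s i i' * m i' j l) = c k * u l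
  antipode_right (k l : ι) : ∑ i, ∑ j, ∑ j', d i j k * (s j j' * m i j' l) = c k * u l

/-- This absence of cancellation is what allows identities between sums of products to be read as
statements about supports. -/
lemma sum_ne_zero_iff_exists {α : Type*} [Fintype α] {f : α → ℝ} (hf : ∀ i, 0 ≤ f i) :
    ∑ i, f i ≠ 0 ↔ ∃ i, f i ≠ 0 := by
  rw [Ne, Finset.sum_eq_zero_iff_of_nonneg fun i _ => hf i]
  simp

namespace NonnegHopf

variable {ι : Type*} [Fintype ι] [DecidableEq ι] (h : NonnegHopf ι)

lemma sum_mul_ne_zero_iff {ι : Type*} [Fintype ι] {f g : ι → ℝ} (hf : ∀ i, 0 ≤ f i)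
    (hg : ∀ i, 0 ≤ g i) :
    ∑ i, f i * g i ≠ 0 ↔ ∃ i, f i ≠ 0 ∧ g i ≠ 0 := by
  simp [sum_ne_zero_iff_exists fun i => mul_nonneg (hf i) (hg i)]

/-- The supports of the structure constants. -/
def toRel : RelHopf ι where
  M i j k := h.m i j k ≠ 0
  D i j k := h.d i j k ≠ 0
  E i := h.u i ≠ 0
  C i := h.c i ≠ 0
  S i j := h.s i j ≠ 0
  assoc i j k l := by
    rw [← sum_mul_ne_zero_iff (fun _ => h.m_nonneg _ _ _) (fun _ => h.m_nonneg _ _ _), h.assoc,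
      sum_mul_ne_zero_iff (fun _ => h.m_nonneg _ _ _) (fun _ => h.m_nonneg _ _ _)]
  coassoc i j k l := by
    rw [← sum_mul_ne_zero_iff (fun _ => h.d_nonneg _ _ _) (fun _ => h.d_nonneg _ _ _), h.coassoc,
      sum_mul_ne_zero_iff (fun _ => h.d_nonneg _ _ _) (fun _ => h.d_nonneg _ _ _)]
  one_left i j := by
    rw [← sum_mul_ne_zero_iff h.u_nonneg (fun _ => h.m_nonneg _ _ _), h.one_left]
    simp
  one_right i j := by
    rw [← sum_mul_ne_zero_iff h.u_nonneg (fun _ => h.m_nonneg _ _ _), h.one_right]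
    simp
  counit_left i j := by
    rw [← sum_mul_ne_zero_iff h.c_nonneg (fun _ => h.d_nonneg _ _ _), h.counit_left]
    simp
  counit_right i j := by
    rw [← sum_mul_ne_zero_iff h.c_nonneg (fun _ => h.d_nonneg _ _ _), h.counit_right]
    simp
  mul_comul i j k l := by
    rw [← sum_mul_ne_zero_iff (fun _ => h.m_nonneg _ _ _) (fun _ => h.d_nonneg _ _ _), h.mul_comul]
    have hm := h.m_nonneg
    have hd := h.d_nonneg
    have hn (p q p' q' : ι) : 0 ≤ h.d p q i * h.d p' q' j * (h.m p p' k * h.m q q' l) :=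
      mul_nonneg (mul_nonneg (hd _ _ _) (hd _ _ _)) (mul_nonneg (hm _ _ _) (hm _ _ _))
    rw [sum_ne_zero_iff_exists fun _ => Finset.sum_nonneg fun _ _ => Finset.sum_nonneg fun _ _ =>
      Finset.sum_nonneg fun _ _ => hn _ _ _ _]
    refine exists_congr fun p => ?_
    rw [sum_ne_zero_iff_exists fun _ => Finset.sum_nonneg fun _ _ =>
      Finset.sum_nonneg fun _ _ => hn _ _ _ _]
    refine exists_congr fun q => ?_
    rw [sum_ne_zero_iff_exists fun _ => Finset.sum_nonneg fun _ _ => hn _ _ _ _]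
    refine exists_congr fun p' => ?_
    rw [sum_ne_zero_iff_exists fun _ => hn _ _ _ _]
    refine exists_congr fun q' => ?_
    simp only [mul_ne_zero_iff, and_assoc]
  comul_one i j := by
    rw [← sum_mul_ne_zero_iff h.u_nonneg (fun _ => h.d_nonneg _ _ _), h.comul_one, mul_ne_zero_iff]
  counit_mul i j := by
    rw [← sum_mul_ne_zero_iff h.c_nonneg (fun _ => h.m_nonneg _ _ _), h.counit_mul, mul_ne_zero_iff]
  counit_one := by
    rw [← sum_mul_ne_zero_iff h.u_nonneg h.c_nonneg, h.counit_one]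
    simp
  antipode_left k l := by
    rw [← mul_ne_zero_iff, ← h.antipode_left]
    have hn (i j i' : ι) : 0 ≤ h.d i j k * (h.s i i' * h.m i' j l) :=
      mul_nonneg (h.d_nonneg _ _ _) (mul_nonneg (h.s_nonneg _ _) (h.m_nonneg _ _ _))
    rw [sum_ne_zero_iff_exists fun _ => Finset.sum_nonneg fun _ _ =>
      Finset.sum_nonneg fun _ _ => hn _ _ _]
    refine exists_congr fun p => ?_
    rw [sum_ne_zero_iff_exists fun _ => Finset.sum_nonneg fun _ _ => hn _ _ _]
    refine exists_congr fun q => ?_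
    rw [sum_ne_zero_iff_exists fun _ => hn _ _ _]
    simp only [mul_ne_zero_iff]
  antipode_right k l := by
    rw [← mul_ne_zero_iff, ← h.antipode_right]
    have hn (i j i' : ι) : 0 ≤ h.d i j k * (h.s j i' * h.m i i' l) :=
      mul_nonneg (h.d_nonneg _ _ _) (mul_nonneg (h.s_nonneg _ _) (h.m_nonneg _ _ _))
    rw [sum_ne_zero_iff_exists fun _ => Finset.sum_nonneg fun _ _ =>
      Finset.sum_nonneg fun _ _ => hn _ _ _]
    refine exists_congr fun p => ?_
    rw [sum_ne_zero_iff_exists fun _ => Finset.sum_nonneg fun _ _ => hn _ _ _]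
    refine exists_congr fun q => ?_
    rw [sum_ne_zero_iff_exists fun _ => hn _ _ _]
    simp only [mul_ne_zero_iff]

end NonnegHopf

/-! ### Structure constants of a positive basis -/

section StructureConstants

variable {H : Type*} [Ring H] [HopfAlgebra ℂ H] {ι : Type*} [Fintype ι]
  {b : Module.Basis ι ℂ H}

lemma IsPositiveBasis.mul_eq (hb : IsPositiveBasis b) (i j : ι) :
    b i * b j = ∑ k, ((b.repr (b i * b j) k).re : ℂ) • b k := by
  conv_lhs => rw [← b.sum_repr (b i * b j)]
  exact Finset.sum_congr rfl fun k _ => by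
    rw [← Complex.eq_re_of_ofReal_le (r := 0) (by simpa using hb.mul_nonneg i j k)]

lemma IsPositiveBasis.one_eq (hb : IsPositiveBasis b) : (1 : H) = ∑ k, ((b.repr 1 k).re : ℂ) • b k
    := by
  conv_lhs => rw [← b.sum_repr 1]
  exact Finset.sum_congr rfl fun k _ => by
    rw [← Complex.eq_re_of_ofReal_le (r := 0) (by simpa using hb.one_nonneg k)]

lemma IsPositiveBasis.counit_eq {ι : Type*} {b : Module.Basis ι ℂ H} (hb : IsPositiveBasis b)
    (i : ι) : Coalgebra.counit (R := ℂ) (b i) =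
    ((Coalgebra.counit (R := ℂ) (b i)).re : ℂ) :=
  Complex.eq_re_of_ofReal_le (r := 0) (by simpa using hb.counit_nonneg i)

lemma IsPositiveBasis.antipode_eq (hb : IsPositiveBasis b) (i : ι) : HopfAlgebra.antipode ℂ (b i) =
    ∑ k, ((b.repr (HopfAlgebra.antipode ℂ (b i)) k).re : ℂ) • b k := by
  conv_lhs => rw [← b.sum_repr (HopfAlgebra.antipode ℂ (b i))]
  exact Finset.sum_congr rfl fun k _ => by
    rw [← Complex.eq_re_of_ofReal_le (r := 0) (by simpa using hb.antipode_nonneg i k)]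

lemma IsPositiveBasis.comul_eq (hb : IsPositiveBasis b) (k : ι) : Coalgebra.comul (R := ℂ) (b k) =
    ∑ i, ∑ j, (((b.tensorProduct b).repr (Coalgebra.comul (b k)) (i, j)).re : ℂ) •
      b i ⊗ₜ[ℂ] b j := by
  conv_lhs => rw [← (b.tensorProduct b).sum_repr (Coalgebra.comul (b k)), Fintype.sum_prod_type]
  exact Finset.sum_congr rfl fun i _ => Finset.sum_congr rfl fun j _ => by
    rw [← Complex.eq_re_of_ofReal_le (r := 0) (by simpa using hb.comul_nonneg k i j),
      Module.Basis.tensorProduct_apply]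

end StructureConstants

section

variable {H : Type*} [Ring H] [HopfAlgebra ℂ H] {ι : Type*} [Fintype ι] [DecidableEq ι]
  {b : Module.Basis ι ℂ H} {m d : ι → ι → ι → ℂ} {u c : ι → ℂ} {s : ι → ι → ℂ}

lemma assoc_of_mul_eq (hm : ∀ i j, b i * b j = ∑ k, (m i j k : ℂ) • b k) (i j k l : ι) :
    ∑ p, m i j p * m p k l = ∑ q, m j k q * m i q l := by
  have e := congrArg (fun t => b.repr t l) (mul_assoc (b i) (b j) (b k))
  simp [hm, Finset.sum_mul, Finset.mul_sum, Finsupp.single_apply] at e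
  exact e

lemma coassoc_of_comul_eq
    (hd : ∀ k, Coalgebra.comul (R := ℂ) (b k) = ∑ i, ∑ j, (d i j k : ℂ) • b i ⊗ₜ[ℂ] b j)
    (i j k l : ι) : ∑ p, d i j p * d p k l = ∑ q, d j k q * d i q l := by
  have e := congrArg (fun t => (b.tensorProduct (b.tensorProduct b)).repr t (i, j, k))
    (Coalgebra.coassoc_apply (R := ℂ) (b l))
  simp [hd, TensorProduct.sum_tmul, TensorProduct.tmul_sum, ← TensorProduct.smul_tmul',
      Finsupp.single_apply] at e
  simpa [mul_comm] using e

lemma one_left_of_mul_eq (hm : ∀ i j, b i * b j = ∑ k, (m i j k : ℂ) • b k)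
    (hu : 1 = ∑ k, u k • b k) (i j : ι) :
    ∑ e, u e * m e i j = if i = j then 1 else 0 := by
  have e := congrArg (fun t => b.repr t j) (one_mul (b i))
  rw [hu] at e
  simp [hm, Finset.sum_mul, Finsupp.single_apply] at e
  exact e

lemma one_right_of_mul_eq (hm : ∀ i j, b i * b j = ∑ k, (m i j k : ℂ) • b k)
    (hu : 1 = ∑ k, u k • b k) (i j : ι) :
    ∑ e, u e * m i e j = if i = j then 1 else 0 := by
  have e := congrArg (fun t => b.repr t j) (mul_one (b i))
  rw [hu] at e
  simp [hm, Finset.mul_sum, Finsupp.single_apply] at e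
  exact e

lemma counit_left_of_comul_eq
    (hd : ∀ k, Coalgebra.comul (R := ℂ) (b k) = ∑ i, ∑ j, (d i j k : ℂ) • b i ⊗ₜ[ℂ] b j)
    (hc : ∀ i, Coalgebra.counit (R := ℂ) (b i) = c i) (i j : ι) :
    ∑ e, c e * d e i j = if i = j then 1 else 0 := by
  have e := congrArg (fun t => b.repr (TensorProduct.lid ℂ H t) i)
    (Coalgebra.rTensor_counit_comul (R := ℂ) (b j))
  simp [hd, hc, Finsupp.single_apply] at e
  simpa [mul_comm, eq_comm] using e

lemma counit_right_of_comul_eq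
    (hd : ∀ k, Coalgebra.comul (R := ℂ) (b k) = ∑ i, ∑ j, (d i j k : ℂ) • b i ⊗ₜ[ℂ] b j)
    (hc : ∀ i, Coalgebra.counit (R := ℂ) (b i) = c i) (i j : ι) :
    ∑ e, c e * d i e j = if i = j then 1 else 0 := by
  have e := congrArg (fun t => b.repr (TensorProduct.rid ℂ H t) i)
    (Coalgebra.lTensor_counit_comul (R := ℂ) (b j))
  simp [hd, hc, Finsupp.single_apply] at e
  simpa [mul_comm, eq_comm] using e

lemma mul_comul_of_eq (hm : ∀ i j, b i * b j = ∑ k, (m i j k : ℂ) • b k)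
    (hd : ∀ k, Coalgebra.comul (R := ℂ) (b k) = ∑ i, ∑ j, (d i j k : ℂ) • b i ⊗ₜ[ℂ] b j)
    (i j k l : ι) : ∑ p, m i j p * d k l p =
      ∑ p, ∑ q, ∑ p', ∑ q', d p q i * d p' q' j * (m p p' k * m q q' l) := by
  have e := congrArg (fun t => (b.tensorProduct b).repr t (k, l))
    (Bialgebra.comul_mul (R := ℂ) (b i) (b j))
  simp [hm, hd, Finset.sum_mul, Finset.mul_sum, Finsupp.single_apply, TensorProduct.sum_tmul,
      TensorProduct.tmul_sum] at e
  have e' := Finset.sum_comm (s := Finset.univ) (t := Finset.univ) (f := fun p q : ι × ι =>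
    d p.1 p.2 i * d q.1 q.2 j * (m p.1 q.1 k * m p.2 q.2 l))
  simp only [Fintype.sum_prod_type] at e'
  rw [e, e']
  refine Finset.sum_congr rfl fun _ _ => Finset.sum_congr rfl fun _ _ =>
    Finset.sum_congr rfl fun _ _ => Finset.sum_congr rfl fun _ _ => ?_
  ring

lemma comul_one_of_eq (hu : 1 = ∑ k, u k • b k)
    (hd : ∀ k, Coalgebra.comul (R := ℂ) (b k) = ∑ i, ∑ j, (d i j k : ℂ) • b i ⊗ₜ[ℂ] b j)
    (i j : ι) : ∑ p, u p * d i j p = u i * u j := by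
  have e := congrArg (fun t => (b.tensorProduct b).repr t (i, j))
    (Bialgebra.comul_one (R := ℂ) (A := H))
  rw [Algebra.TensorProduct.one_def, hu] at e
  simpa [hd, Finsupp.single_apply, mul_comm] using e

omit [DecidableEq ι] in
lemma counit_mul_of_eq (hm : ∀ i j, b i * b j = ∑ k, (m i j k : ℂ) • b k)
    (hc : ∀ i, Coalgebra.counit (R := ℂ) (b i) = c i) (i j : ι) :
    ∑ p, c p * m i j p = c i * c j := by
  have e := Bialgebra.counit_mul (R := ℂ) (b i) (b j)
  simp only [hm, hc, map_sum, map_smul, smul_eq_mul] at e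
  simp_rw [mul_comm (c _) (m _ _ _)]
  exact e

omit [DecidableEq ι] in
lemma counit_one_of_eq (hu : 1 = ∑ k, u k • b k)
    (hc : ∀ i, Coalgebra.counit (R := ℂ) (b i) = c i) : ∑ p, u p * c p = 1 := by
  have e := Bialgebra.counit_one (R := ℂ) (A := H)
  rw [hu] at e
  simp [hc] at e
  exact e

lemma antipode_left_of_eq (hm : ∀ i j, b i * b j = ∑ k, (m i j k : ℂ) • b k)
    (hd : ∀ k, Coalgebra.comul (R := ℂ) (b k) = ∑ i, ∑ j, (d i j k : ℂ) • b i ⊗ₜ[ℂ] b j)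
    (hu : 1 = ∑ k, u k • b k) (hc : ∀ i, Coalgebra.counit (R := ℂ) (b i) = c i)
    (hs : ∀ i, HopfAlgebra.antipode ℂ (b i) = ∑ j, s i j • b j) (k l : ι) :
    ∑ i, ∑ j, ∑ i', d i j k * (s i i' * m i' j l) = c k * u l := by
  have e := congrArg (fun t => b.repr t l) (HopfAlgebra.mul_antipode_rTensor_comul_apply (R := ℂ)
      (b k))
  rw [Algebra.algebraMap_eq_smul_one, hu] at e
  simp [hd, hc, hs, hm, Finsupp.single_apply, Finset.smul_sum, TensorProduct.sum_tmul] at e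
  exact e

lemma antipode_right_of_eq (hm : ∀ i j, b i * b j = ∑ k, (m i j k : ℂ) • b k)
    (hd : ∀ k, Coalgebra.comul (R := ℂ) (b k) = ∑ i, ∑ j, (d i j k : ℂ) • b i ⊗ₜ[ℂ] b j)
    (hu : 1 = ∑ k, u k • b k) (hc : ∀ i, Coalgebra.counit (R := ℂ) (b i) = c i)
    (hs : ∀ i, HopfAlgebra.antipode ℂ (b i) = ∑ j, s i j • b j) (k l : ι) :
    ∑ i, ∑ j, ∑ j', d i j k * (s j j' * m i j' l) = c k * u l := by
  have e := congrArg (fun t => b.repr t l) (HopfAlgebra.mul_antipode_lTensor_comul_apply (R := ℂ)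
      (b k))
  rw [Algebra.algebraMap_eq_smul_one, hu] at e
  simp [hd, hc, hs, hm, Finsupp.single_apply, Finset.smul_sum, TensorProduct.tmul_sum] at e
  exact e

/-- The structure constants of a Hopf algebra with respect to a positive basis. -/
noncomputable def IsPositiveBasis.consts (hb : IsPositiveBasis b) : NonnegHopf ι where
  m i j k := (b.repr (b i * b j) k).re
  d i j k := ((b.tensorProduct b).repr (Coalgebra.comul (b k)) (i, j)).re
  u k := (b.repr 1 k).re
  c i := (Coalgebra.counit (R := ℂ) (b i)).re
  s i j := (b.repr (HopfAlgebra.antipode ℂ (b i)) j).re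
  m_nonneg i j k := (Complex.nonneg_iff.1 (hb.mul_nonneg i j k)).1
  d_nonneg i j k := (Complex.nonneg_iff.1 (hb.comul_nonneg k i j)).1
  u_nonneg i := (Complex.nonneg_iff.1 (hb.one_nonneg i)).1
  c_nonneg i := (Complex.nonneg_iff.1 (hb.counit_nonneg i)).1
  s_nonneg i j := (Complex.nonneg_iff.1 (hb.antipode_nonneg i j)).1
  assoc := by intros; exact_mod_cast assoc_of_mul_eq hb.mul_eq ..
  coassoc := by intros; exact_mod_cast coassoc_of_comul_eq hb.comul_eq ..
  one_left i j := Complex.ofReal_injective <| by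
    push_cast
    exact (one_left_of_mul_eq hb.mul_eq hb.one_eq i j).trans (by split_ifs <;> simp)
  one_right i j := Complex.ofReal_injective <| by
    push_cast
    exact (one_right_of_mul_eq hb.mul_eq hb.one_eq i j).trans (by split_ifs <;> simp)
  counit_left i j := Complex.ofReal_injective <| by
    push_cast
    exact (counit_left_of_comul_eq hb.comul_eq hb.counit_eq i j).trans (by split_ifs <;> simp)
  counit_right i j := Complex.ofReal_injective <| by
    push_cast
    exact (counit_right_of_comul_eq hb.comul_eq hb.counit_eq i j).trans (by split_ifs <;> simp)
  mul_comul := by intros; exact_mod_cast mul_comul_of_eq hb.mul_eq hb.comul_eq ..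
  comul_one := by intros; exact_mod_cast comul_one_of_eq hb.one_eq hb.comul_eq ..
  counit_mul := by intros; exact_mod_cast counit_mul_of_eq hb.mul_eq hb.counit_eq ..
  counit_one := by exact_mod_cast counit_one_of_eq hb.one_eq hb.counit_eq ..
  antipode_left := by
    intros
    exact_mod_cast
      antipode_left_of_eq hb.mul_eq hb.comul_eq hb.one_eq hb.counit_eq hb.antipode_eq ..
  antipode_right := by
    intros
    exact_mod_cast
      antipode_right_of_eq hb.mul_eq hb.comul_eq hb.one_eq hb.counit_eq hb.antipode_eq ..

end
-- Triviality of positive cocycles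
namespace MatchedPair

variable {I J : Type*} [Group I] [Group J] (mp : MatchedPair I J)

/-- The right action of `x : J` on `I` as a permutation. -/
def actEquiv (x : J) : I ≃ I where
  toFun i := mp.act i x
  invFun i := mp.act i x⁻¹
  left_inv i := by dsimp only; rw [← mp.act_mul, mul_inv_cancel, mp.act_one]
  right_inv i := by dsimp only; rw [← mp.act_mul, inv_mul_cancel, mp.act_one]

@[simp] lemma actEquiv_apply (x : J) (i : I) : mp.actEquiv x i = mp.act i x := rfl

lemma act_inv_act (i : I) (x : J) : mp.act (mp.act i x⁻¹) x = i := (mp.actEquiv x).right_inv i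

/-- Additive `2`-cocycles of a matched pair of finite groups with real values are trivial. -/
lemma exists_add_trivialization [Fintype I] [Fintype J] (m : I → J → J → ℝ) (w : I → I → J → ℝ)
    (hm : ∀ u x y z, m u x y + m u (x * y) z = m (mp.act u x) y z + m u x (y * z))
    (hw : ∀ c d k x, w (c * d) k x + w c d (mp.co k x) = w c (d * k) x + w d k x)
    (hmw : ∀ c d x y, m (c * d) x y + w c d (x * y) =
      w c d x + w (mp.act c (mp.co d x)) (mp.act d x) y +
        (m c (mp.co d x) (mp.co (mp.act d x) y) + m d x y)) :
    ∃ l : I → J → ℝ, (∀ u x y, l u x + l (mp.act u x) y + m u x y = l u (x * y)) ∧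
      ∀ c d x, l (c * d) x + w c d x = l c (mp.co d x) + l d x := by
  have hJ : (Fintype.card J : ℝ) ≠ 0 := by simp
  have hI : (Fintype.card I : ℝ) ≠ 0 := by simp
  obtain ⟨φ, hφ⟩ : ∃ φ : I → J → ℝ, ∀ u x y,
      φ u x + φ (mp.act u x) y + m u x y = φ u (x * y) := by
    -- Averaging the cocycle identity over `z`; translation by `y` permutes J, so the last sum loses
    -- its dependence on `y`.
    refine ⟨fun u x => -(∑ z, m u x z) / Fintype.card J, fun u x y => ?_⟩
    have h1 := Finset.sum_congr rfl fun z (_ : z ∈ (Finset.univ : Finset J)) => hm u x y z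
    simp only [Finset.sum_add_distrib, Finset.sum_const, Finset.card_univ, nsmul_eq_mul] at h1
    have h2 : ∑ z, m u x (y * z) = ∑ z, m u x z := Equiv.sum_comp (Equiv.mulLeft y) (m u x)
    rw [h2] at h1
    field_simp
    linarith
  -- After `φ` removes `m`, the remaining `w'` is still a cocycle in the I-direction (`hB`) and is
  -- additive along J (`hC`).
  obtain ⟨w', hw'⟩ : ∃ w' : I → I → J → ℝ, ∀ c d x,
      w' c d x = w c d x + φ (c * d) x - φ c (mp.co d x) - φ d x := ⟨_, fun _ _ _ => rfl⟩
  have hB (c d k x) : w' (c * d) k x + w' c d (mp.co k x) = w' c (d * k) x + w' d k x := by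
    simp only [hw', mp.mul_co, mul_assoc]
    linarith [hw c d k x]
  have hC (c d x y) : w' c d (x * y) = w' c d x + w' (mp.act c (mp.co d x)) (mp.act d x) y := by
    simp only [hw', mp.co_mul, ← mp.mul_act]
    linarith [hmw c d x y, hφ (c * d) x y, hφ c (mp.co d x) (mp.co (mp.act d x) y), hφ d x y]
  -- Averaging over the first argument trivialises `w'`. By `hψ2` the average is additive along J,
  -- so adding it to `φ` leaves the first identity intact.
  obtain ⟨ψ, hψ⟩ : ∃ ψ : I → J → ℝ, ∀ u x, ψ u x = (∑ c, w' c u x) / Fintype.card I :=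
    ⟨_, fun _ _ => rfl⟩
  have hψ1 (d k x) : ψ (d * k) x + w' d k x = ψ d (mp.co k x) + ψ k x := by
    have h1 := Finset.sum_congr rfl fun c (_ : c ∈ (Finset.univ : Finset I)) => hB c d k x
    simp only [Finset.sum_add_distrib, Finset.sum_const, Finset.card_univ, nsmul_eq_mul] at h1
    have h2 : ∑ c, w' (c * d) k x = ∑ c, w' c k x :=
      Equiv.sum_comp (Equiv.mulRight d) (fun c => w' c k x)
    rw [h2] at h1
    simp only [hψ]
    field_simp
    linarith
  have hψ2 (u x y) : ψ u (x * y) = ψ u x + ψ (mp.act u x) y := by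
    have h1 := Finset.sum_congr rfl fun c (_ : c ∈ (Finset.univ : Finset I)) => hC c u x y
    simp only [Finset.sum_add_distrib] at h1
    have h2 : ∑ c, w' (mp.act c (mp.co u x)) (mp.act u x) y = ∑ c, w' c (mp.act u x) y :=
      (mp.actEquiv (mp.co u x)).sum_comp (fun c => w' c (mp.act u x) y)
    rw [h2] at h1
    simp only [hψ, h1]
    ring
  refine ⟨fun u x => φ u x + ψ u x, fun u x y => ?_, fun c d x => ?_⟩
  · simp only [hψ2, ← hφ]
    ring
  · linarith [hψ1 c d x, hw' c d x]

/-- Positive `2`-cocycles of a matched pair of finite groups are trivial. -/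
lemma exists_trivialization [Fintype I] [Fintype J] (m : I → J → J → ℝ) (w : I → I → J → ℝ)
    (hm0 : ∀ u x y, 0 < m u x y) (hw0 : ∀ c d x, 0 < w c d x)
    (hm : ∀ u x y z, m u x y * m u (x * y) z = m (mp.act u x) y z * m u x (y * z))
    (hw : ∀ c d k x, w (c * d) k x * w c d (mp.co k x) = w c (d * k) x * w d k x)
    (hmw : ∀ c d x y, m (c * d) x y * w c d (x * y) =
      w c d x * w (mp.act c (mp.co d x)) (mp.act d x) y *
        (m c (mp.co d x) (mp.co (mp.act d x) y) * m d x y)) :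
    ∃ l : I → J → ℝ, (∀ u x, 0 < l u x) ∧
      (∀ u x y, l u x * l (mp.act u x) y * m u x y = l u (x * y)) ∧
      ∀ c d x, l (c * d) x * w c d x = l c (mp.co d x) * l d x := by
  -- Positivity permits logarithms, which reduce the claim to real coefficients, where division by
  -- the group orders is possible.
  obtain ⟨l, h1, h2⟩ := mp.exists_add_trivialization (fun u x y => Real.log (m u x y))
    (fun u x y => Real.log (w u x y))
    (fun u x y z => by
      have := congrArg Real.log (hm u x y z)
      rwa [Real.log_mul (hm0 _ _ _).ne' (hm0 _ _ _).ne',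
        Real.log_mul (hm0 _ _ _).ne' (hm0 _ _ _).ne'] at this)
    (fun u x y z => by
      have := congrArg Real.log (hw u x y z)
      rwa [Real.log_mul (hw0 _ _ _).ne' (hw0 _ _ _).ne',
        Real.log_mul (hw0 _ _ _).ne' (hw0 _ _ _).ne'] at this)
    (fun u x y z => by
      have := congrArg Real.log (hmw u x y z)
      rwa [Real.log_mul (hm0 _ _ _).ne' (hw0 _ _ _).ne', Real.log_mul
        (mul_pos (hw0 _ _ _) (hw0 _ _ _)).ne' (mul_pos (hm0 _ _ _) (hm0 _ _ _)).ne',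
        Real.log_mul (hw0 _ _ _).ne' (hw0 _ _ _).ne',
        Real.log_mul (hm0 _ _ _).ne' (hm0 _ _ _).ne'] at this)
  refine ⟨fun u x => Real.exp (l u x), fun u x => Real.exp_pos _, fun u x y => ?_,
    fun c d x => ?_⟩
  · dsimp only
    rw [← h1, Real.exp_add, Real.exp_add, Real.exp_log (hm0 _ _ _)]
  · dsimp only
    rw [← Real.exp_add, ← h2, Real.exp_add, Real.exp_log (hw0 _ _ _)]

end MatchedPair

/-! ### Normalising the basis to a bicrossproduct basis -/

section

variable {H : Type*} [Ring H] [HopfAlgebra ℂ H] {I J : Type*} [Group I] [Group J]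
  [Fintype I] [DecidableEq I]

/-- A basis indexed by the arrows of a matched pair of groups on which the bialgebra operations are
those of the associated bicrossproduct. -/
structure IsBicrossedBasis (mp : MatchedPair I J) (e : Module.Basis (I × J) ℂ H) : Prop where
  mul (u v : I) (x y : J) : e (u, x) * e (v, y) = if mp.act u x = v then e (u, x * y) else 0
  one : 1 = ∑ u, e (u, 1)
  comul (u : I) (x : J) : Coalgebra.comul (R := ℂ) (e (u, x)) =
    ∑ h, e (u * h⁻¹, mp.co h x) ⊗ₜ[ℂ] e (h, x)
  counit (u : I) (x : J) : Coalgebra.counit (R := ℂ) (e (u, x)) = if u = 1 then 1 else 0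

end

lemma sum_four_eq_single {ι : Type*} [Fintype ι] [DecidableEq ι] {F : ι → ι → ι → ι → ℝ}
    (a b c d : ι) (hF : ∀ a' b' c' d', F a' b' c' d' ≠ 0 → a' = a ∧ b' = b ∧ c' = c ∧ d' = d) :
    ∑ a', ∑ b', ∑ c', ∑ d', F a' b' c' d' = F a b c d := by
  have e := Finset.sum_eq_single (s := Finset.univ)
    (f := fun p : ι × ι × ι × ι => F p.1 p.2.1 p.2.2.1 p.2.2.2) (a, b, c, d)
    (fun p _ hp => by
      by_contra h
      obtain ⟨h1, h2, h3, h4⟩ := hF _ _ _ _ h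
      exact hp (by ext <;> assumption)) (by simp)
  simpa only [Fintype.sum_prod_type] using e

instance {ι : Type*} [Finite ι] (h : RelHopf ι) : Finite h.I := Subtype.finite

namespace NonnegHopf

variable {ι : Type*} [Fintype ι] [DecidableEq ι] (h : NonnegHopf ι)

/-- The basis element with source `u` and cotarget `x`. -/
noncomputable abbrev arrow (u : h.toRel.I) (x : h.toRel.dual.I) : ι := h.toRel.arrow u x

/-- The matched pair determined by non-negative structure constants. -/
noncomputable abbrev pair : MatchedPair h.toRel.I h.toRel.dual.I := h.toRel.matchedPair

/-- The non-zero structure constants of the multiplication. -/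
noncomputable def mulCoeff (u : h.toRel.I) (x y : h.toRel.dual.I) : ℝ :=
  h.m (h.arrow u x) (h.arrow (h.pair.act u x) y) (h.arrow u (x * y))

/-- The non-zero structure constants of the comultiplication. -/
noncomputable def comulCoeff (u v : h.toRel.I) (x : h.toRel.dual.I) : ℝ :=
  h.d (h.arrow u (h.pair.co v x)) (h.arrow v x) (h.arrow (u * v) x)

variable {h}

lemma mulCoeff_pos (u : h.toRel.I) (x y : h.toRel.dual.I) : 0 < h.mulCoeff u x y :=
  (h.m_nonneg _ _ _).lt_of_ne' (RelHopf.mul_arrow (h := h.toRel) u x y)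

lemma comulCoeff_pos (u v : h.toRel.I) (x : h.toRel.dual.I) : 0 < h.comulCoeff u v x :=
  (h.d_nonneg _ _ _).lt_of_ne' (RelHopf.comul_arrow (h := h.toRel) u v x)

lemma eq_of_m_ne_zero {u v : h.toRel.I} {x y : h.toRel.dual.I} {k : ι}
    (hm : h.m (h.arrow u x) (h.arrow v y) k ≠ 0) : h.pair.act u x = v ∧ k = h.arrow u (x * y) := by
  obtain ⟨h1, h2, h3⟩ := (RelHopf.mul_iff (h := h.toRel)).1 hm
  rw [RelHopf.src_arrow] at h1 h2
  rw [RelHopf.cotgt_arrow, RelHopf.cotgt_arrow] at h3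
  exact ⟨h1, RelHopf.eq_arrow h2 h3⟩

lemma eq_of_d_ne_zero {u v : h.toRel.I} {x y : h.toRel.dual.I} {k : ι}
    (hd : h.d (h.arrow u x) (h.arrow v y) k ≠ 0) : x = h.pair.co v y ∧ k = h.arrow (u * v) y := by
  obtain ⟨h1, h2, h3⟩ := (RelHopf.comul_iff (h := h.toRel)).1 hd
  rw [RelHopf.src_arrow, RelHopf.src_arrow] at h2
  rw [RelHopf.cotgt_arrow] at h1 h3
  exact ⟨h1, RelHopf.eq_arrow h2 h3⟩

lemma sum_m_mul (u : h.toRel.I) (x y : h.toRel.dual.I) (f : ι → ℝ) :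
    ∑ p, h.m (h.arrow u x) (h.arrow (h.pair.act u x) y) p * f p =
      h.mulCoeff u x y * f (h.arrow u (x * y)) := by
  refine Finset.sum_eq_single _ (fun p _ hp => ?_) (by simp)
  by_contra hne
  exact hp (eq_of_m_ne_zero (left_ne_zero_of_mul hne)).2

lemma sum_d_mul (u v : h.toRel.I) (x : h.toRel.dual.I) (f : ι → ℝ) :
    ∑ p, h.d (h.arrow u (h.pair.co v x)) (h.arrow v x) p * f p =
      h.comulCoeff u v x * f (h.arrow (u * v) x) := by
  refine Finset.sum_eq_single _ (fun p _ hp => ?_) (by simp)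
  by_contra hne
  exact hp (eq_of_d_ne_zero (left_ne_zero_of_mul hne)).2

/-- Associativity for three composable arrows: the supports leave one term in each sum. -/
lemma mulCoeff_cocycle (u : h.toRel.I) (x y z : h.toRel.dual.I) :
    h.mulCoeff u x y * h.mulCoeff u (x * y) z =
      h.mulCoeff (h.pair.act u x) y z * h.mulCoeff u x (y * z) := by
  have e := h.assoc (h.arrow u x) (h.arrow (h.pair.act u x) y) (h.arrow (h.pair.act u (x * y)) z)
    (h.arrow u (x * y * z))
  rw [sum_m_mul, h.pair.act_mul u x y, sum_m_mul] at e
  have e1 : h.mulCoeff u (x * y) z = h.m (h.arrow u (x * y))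
      (h.arrow (h.pair.act (h.pair.act u x) y) z) (h.arrow u (x * y * z)) := by
    rw [mulCoeff, h.pair.act_mul]
  have e2 : h.mulCoeff u x (y * z) = h.m (h.arrow u x)
      (h.arrow (h.pair.act u x) (y * z)) (h.arrow u (x * y * z)) := by
    rw [mulCoeff, mul_assoc]
  rw [e1, e2, e]

lemma comulCoeff_cocycle (c d k : h.toRel.I) (x : h.toRel.dual.I) :
    h.comulCoeff (c * d) k x * h.comulCoeff c d (h.pair.co k x) =
      h.comulCoeff c (d * k) x * h.comulCoeff d k x := by
  have e := h.coassoc (h.arrow c (h.pair.co (d * k) x)) (h.arrow d (h.pair.co k x)) (h.arrow k x)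
    (h.arrow (c * d * k) x)
  rw [sum_d_mul, h.pair.mul_co d k x, sum_d_mul] at e
  have e1 : h.comulCoeff c (d * k) x = h.d (h.arrow c (h.pair.co d (h.pair.co k x)))
      (h.arrow (d * k) x) (h.arrow (c * d * k) x) := by
    rw [comulCoeff, h.pair.mul_co, mul_assoc]
  have e2 : h.comulCoeff (c * d) k x = h.d (h.arrow (c * d) (h.pair.co k x))
      (h.arrow k x) (h.arrow (c * d * k) x) := rfl
  rw [mul_comm, e1, e2, e, mul_comm]

/-- The bialgebra axiom at one coefficient; source and cotarget determine all four summation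
indices. -/
lemma mulCoeff_comulCoeff (c d : h.toRel.I) (x y : h.toRel.dual.I) :
    h.mulCoeff (c * d) x y * h.comulCoeff c d (x * y) =
      h.comulCoeff c d x * h.comulCoeff (h.pair.act c (h.pair.co d x)) (h.pair.act d x) y *
        (h.mulCoeff c (h.pair.co d x) (h.pair.co (h.pair.act d x) y) * h.mulCoeff d x y) := by
  have e := h.mul_comul (h.arrow (c * d) x) (h.arrow (h.pair.act (c * d) x) y)
    (h.arrow c (h.pair.co d (x * y))) (h.arrow d (x * y))
  rw [sum_m_mul, sum_four_eq_single (h.arrow c (h.pair.co d x)) (h.arrow d x)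
    (h.arrow (h.pair.act c (h.pair.co d x)) (h.pair.co (h.pair.act d x) y))
    (h.arrow (h.pair.act d x) y)] at e
  · have e1 : h.comulCoeff (h.pair.act c (h.pair.co d x)) (h.pair.act d x) y =
        h.d (h.arrow (h.pair.act c (h.pair.co d x)) (h.pair.co (h.pair.act d x) y))
          (h.arrow (h.pair.act d x) y) (h.arrow (h.pair.act (c * d) x) y) := by
      rw [comulCoeff, h.pair.mul_act]
    have e2 : h.mulCoeff c (h.pair.co d x) (h.pair.co (h.pair.act d x) y) =
        h.m (h.arrow c (h.pair.co d x)) (h.arrow (h.pair.act c (h.pair.co d x))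
          (h.pair.co (h.pair.act d x) y)) (h.arrow c (h.pair.co d (x * y))) := by
      rw [mulCoeff, h.pair.co_mul]
    rw [e1, e2]
    exact e
  · intro p q p' q' hne
    have h1 := (RelHopf.comul_iff (h := h.toRel)).1 (left_ne_zero_of_mul (left_ne_zero_of_mul hne)
        : h.toRel.D _ _ _)
    have h2 := (RelHopf.comul_iff (h := h.toRel)).1
      (right_ne_zero_of_mul (left_ne_zero_of_mul hne) : h.toRel.D _ _ _)
    have h3 := (RelHopf.mul_iff (h := h.toRel)).1 (left_ne_zero_of_mul (right_ne_zero_of_mul hne) :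
        h.toRel.M _ _ _)
    have h4 := (RelHopf.mul_iff (h := h.toRel)).1
      (right_ne_zero_of_mul (right_ne_zero_of_mul hne) : h.toRel.M _ _ _)
    simp only [RelHopf.src_arrow, RelHopf.cotgt_arrow] at h1 h2 h3 h4
    obtain rfl := RelHopf.eq_arrow h4.2.1.symm h1.2.2.symm
    obtain rfl := RelHopf.eq_arrow h3.2.1.symm h1.1
    obtain rfl := RelHopf.eq_arrow h4.1.symm h2.2.2.symm
    obtain rfl := RelHopf.eq_arrow h3.1.symm h2.1
    exact ⟨rfl, rfl, rfl, rfl⟩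

end NonnegHopf

section

variable {H : Type*} [Ring H] [HopfAlgebra ℂ H] {ι : Type*} [Fintype ι] [DecidableEq ι]
  {b : Module.Basis ι ℂ H}

open Classical in
lemma IsPositiveBasis.mul_arrow (hb : IsPositiveBasis b) (u v : hb.consts.toRel.I)
    (x y : hb.consts.toRel.dual.I) :
    b (hb.consts.arrow u x) * b (hb.consts.arrow v y) =
      if hb.consts.pair.act u x = v then
        (hb.consts.mulCoeff u x y : ℂ) • b (hb.consts.arrow u (x * y)) else 0 := by
  have e : b (hb.consts.arrow u x) * b (hb.consts.arrow v y) =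
    ∑ k, (hb.consts.m (hb.consts.arrow u x) (hb.consts.arrow v y) k : ℂ) • b k := hb.mul_eq _ _
  rw [e]
  split_ifs with h
  · subst h
    refine Finset.sum_eq_single _ (fun k _ hk => ?_) (by simp)
    have : hb.consts.m (hb.consts.arrow u x)
        (hb.consts.arrow (hb.consts.pair.act u x) y) k = 0 := by
      by_contra hne
      exact hk (NonnegHopf.eq_of_m_ne_zero hne).2
    rw [this, Complex.ofReal_zero, zero_smul]
  · refine Finset.sum_eq_zero fun k _ => ?_
    have : hb.consts.m (hb.consts.arrow u x) (hb.consts.arrow v y) k = 0 := by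
      by_contra hne
      exact h (NonnegHopf.eq_of_m_ne_zero hne).1
    rw [this, Complex.ofReal_zero, zero_smul]

lemma IsPositiveBasis.comul_arrow (hb : IsPositiveBasis b) [Fintype hb.consts.toRel.I]
    (u : hb.consts.toRel.I) (x : hb.consts.toRel.dual.I) :
    Coalgebra.comul (R := ℂ) (b (hb.consts.arrow u x)) =
      ∑ k, (hb.consts.comulCoeff (u * k⁻¹) k x : ℂ) •
        b (hb.consts.arrow (u * k⁻¹) (hb.consts.pair.co k x)) ⊗ₜ[ℂ] b (hb.consts.arrow k x) := by
  have e : Coalgebra.comul (R := ℂ) (b (hb.consts.arrow u x)) =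
    ∑ i, ∑ j, (hb.consts.d i j (hb.consts.arrow u x) : ℂ) • b i ⊗ₜ[ℂ] b j := hb.comul_eq _
  have := Fintype.ofFinite hb.consts.toRel.dual.I
  rw [e, Finset.sum_comm, ← hb.consts.toRel.arrowEquiv.sum_comp, Fintype.sum_prod_type]
  refine Finset.sum_congr rfl fun k _ => ?_
  have hz (i : ι) (y : hb.consts.toRel.dual.I)
      (hne : hb.consts.d i (hb.consts.arrow k y) (hb.consts.arrow u x) ≠ 0) :
      y = x ∧ i = hb.consts.arrow (u * k⁻¹) (hb.consts.pair.co k x) := by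
    have h := (RelHopf.comul_iff (h := hb.consts.toRel)).1 hne
    simp only [RelHopf.src_arrow, RelHopf.cotgt_arrow] at h
    obtain ⟨h1, h2, rfl⟩ := h
    exact ⟨rfl, RelHopf.eq_arrow (eq_mul_inv_of_mul_eq h2.symm) h1⟩
  rw [Finset.sum_eq_single x, Finset.sum_eq_single
    (hb.consts.arrow (u * k⁻¹) (hb.consts.pair.co k x))]
  · congr 2
    rw [NonnegHopf.comulCoeff, inv_mul_cancel_right]
    rfl
  · intro i _ hi
    have : hb.consts.d i (hb.consts.arrow k x) (hb.consts.arrow u x) = 0 := by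
      by_contra hne
      exact hi (hz _ _ hne).2
    simp [RelHopf.arrowEquiv, this]
  · simp
  · intro y _ hy
    refine Finset.sum_eq_zero fun i _ => ?_
    have : hb.consts.d i (hb.consts.arrow k y) (hb.consts.arrow u x) = 0 := by
      by_contra hne
      exact hy (hz _ _ hne).1
    simp [RelHopf.arrowEquiv, this]
  · simp

/-- The unit and the counit are determined by the product and the coproduct, so the rescaling need
not be checked against them. -/
lemma isBicrossedBasis_of_mul_of_comul {I J : Type*} [Group I] [Group J] [Fintype I] [Fintype J]
    [DecidableEq I] {mp : MatchedPair I J} {e : Module.Basis (I × J) ℂ H}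
    (hmul : ∀ (u v : I) (x y : J),
      e (u, x) * e (v, y) = if mp.act u x = v then e (u, x * y) else 0)
    (hcomul : ∀ (u : I) (x : J), Coalgebra.comul (R := ℂ) (e (u, x)) =
      ∑ h, e (u * h⁻¹, mp.co h x) ⊗ₜ[ℂ] e (h, x)) : IsBicrossedBasis mp e := by
  classical
  refine ⟨hmul, ?_, hcomul, fun u x => ?_⟩
  · have key (u : I) (x : J) : e.repr 1 (u, x) = if x = 1 then 1 else 0 := by
      have h1 := congrArg (fun t => e.repr t (u, x)) (one_mul (e (mp.act u x, 1)))
      rw [← e.sum_repr 1, Fintype.sum_prod_type] at h1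
      simp only [Finset.sum_mul, smul_mul_assoc, hmul, mul_one] at h1
      rw [map_sum, Finsupp.finsetSum_apply, Finset.sum_eq_single u, map_sum,
        Finsupp.finsetSum_apply, Finset.sum_eq_single x] at h1
      · simp only [if_true, map_smul, Module.Basis.repr_self, Finsupp.smul_apply,
          Finsupp.single_eq_same, smul_eq_mul, mul_one] at h1
        rw [h1, Finsupp.single_apply]
        refine if_congr ⟨fun h => (congrArg Prod.snd h).symm, ?_⟩ rfl rfl
        rintro rfl
        rw [mp.act_one]
      · intro y _ hy
        split_ifs <;> simp [hy]
      · simp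
      · intro v _ hv
        rw [map_sum, Finsupp.finsetSum_apply]
        refine Finset.sum_eq_zero fun y _ => ?_
        split_ifs <;> simp [hv]
      · simp
    conv_lhs => rw [← e.sum_repr 1, Fintype.sum_prod_type]
    simp [key]
  · have h1 := congrArg (fun t => e.repr (TensorProduct.lid ℂ H t) (1, x))
      (Coalgebra.rTensor_counit_comul (R := ℂ) (e (u, x)))
    simp only [hcomul, map_sum, LinearMap.rTensor_tmul, TensorProduct.lid_tmul, map_smul,
      Module.Basis.repr_self, Finsupp.finsetSum_apply, Finsupp.smul_apply,
      Finsupp.single_apply, one_smul] at h1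
    rw [Finset.sum_eq_single 1] at h1
    · simpa [mp.one_co] using h1
    · intro k _ hk
      simp [hk]
    · simp

theorem IsPositiveBasis.exists_isBicrossedBasis {ι : Type} [Finite ι] {b : Module.Basis ι ℂ H}
    (hb : IsPositiveBasis b) :
    ∃ (I J : Type) (_ : Group I) (_ : Group J) (_ : Fintype I) (_ : Fintype J) (_ : DecidableEq I)
      (mp : MatchedPair I J) (e : Module.Basis (I × J) ℂ H) (f : I × J ≃ ι) (l : I × J → ℝ),
      IsBicrossedBasis mp e ∧ (∀ p, 0 < l p) ∧ ∀ p, e p = (l p : ℂ) • b (f p) := by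
  classical
  have := Fintype.ofFinite ι
  have := Fintype.ofFinite hb.consts.toRel.I
  have := Fintype.ofFinite hb.consts.toRel.dual.I
  obtain ⟨l, hl0, hl1, hl2⟩ := hb.consts.pair.exists_trivialization hb.consts.mulCoeff
    hb.consts.comulCoeff NonnegHopf.mulCoeff_pos NonnegHopf.comulCoeff_pos
    NonnegHopf.mulCoeff_cocycle NonnegHopf.comulCoeff_cocycle NonnegHopf.mulCoeff_comulCoeff
  -- The cochain `l` rescales each arrow, and its two identities absorb `mulCoeff` and `comulCoeff`.
  let e : Module.Basis _ ℂ H := (b.reindex hb.consts.toRel.arrowEquiv.symm).isUnitSMul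
    (w := fun p => (l p.1 p.2 : ℂ)) fun p => by simpa using (hl0 p.1 p.2).ne'
  have he (u x) : e (u, x) = (l u x : ℂ) • b (hb.consts.arrow u x) := by
    simp [e, Module.Basis.isUnitSMul_apply, RelHopf.arrowEquiv]
  have hmul (u v : hb.consts.toRel.I) (x y : hb.consts.toRel.dual.I) :
      e (u, x) * e (v, y) = if hb.consts.pair.act u x = v then e (u, x * y) else 0 := by
    rw [he, he, he, smul_mul_smul_comm, hb.mul_arrow]
    split_ifs with h
    · rw [smul_smul, ← hl1, h]
      push_cast
      rfl
    · simp
  have hcomul (u : hb.consts.toRel.I) (x : hb.consts.toRel.dual.I) :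
      Coalgebra.comul (R := ℂ) (e (u, x)) =
        ∑ k, e (u * k⁻¹, hb.consts.pair.co k x) ⊗ₜ[ℂ] e (k, x) := by
    rw [he, map_smul, hb.comul_arrow, Finset.smul_sum]
    refine Finset.sum_congr rfl fun k _ => ?_
    rw [he, he, TensorProduct.smul_tmul_smul, smul_smul]
    congr 1
    have := hl2 (u * k⁻¹) k x
    rw [inv_mul_cancel_right] at this
    exact_mod_cast this
  refine ⟨_, _, inferInstance, inferInstance, inferInstance, inferInstance, inferInstance,
    hb.consts.pair, e, hb.consts.toRel.arrowEquiv, fun p => l p.1 p.2,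
    isBicrossedBasis_of_mul_of_comul hmul hcomul, fun p => hl0 _ _, fun p => he _ _⟩

end

/-! ### Calculus with one arrow at each source -/

section ArrowSum

variable {X M A : Type*} [Fintype X] [Ring A] [Algebra ℂ A]

/-- The linear combination of arrows `e p (f p)`, one for each source `p`. -/
noncomputable def arrowSum (e : X → M → A) (r : X → ℂ) (f : X → M) : A := ∑ p, r p • e p (f p)

/-- The arrow at `p` composes only with the arrow starting at its end, so elements with one arrow
per source are closed under multiplication. -/
lemma arrowSum_mul [DecidableEq X] [Mul M] {e : X → M → A} {act : X → M → X}
    (he : ∀ p q x y, e p x * e q y = if act p x = q then e p (x * y) else 0)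
    (r s : X → ℂ) (f g : X → M) : arrowSum e r f * arrowSum e s g =
      arrowSum e (fun p => r p * s (act p (f p))) (fun p => f p * g (act p (f p))) := by
  rw [arrowSum, arrowSum, arrowSum, Finset.sum_mul]
  refine Finset.sum_congr rfl fun p _ => ?_
  rw [Finset.mul_sum, Finset.sum_eq_single (act p (f p))]
  · rw [smul_mul_smul_comm, he, if_pos rfl]
  · intro q _ hq
    rw [smul_mul_smul_comm, he, if_neg hq.symm, smul_zero]
  · simp

lemma arrowSum_congr {e : X → M → A} {r s : X → ℂ} {f g : X → M} (h : ∀ p, r p = s p)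
    (h' : ∀ p, s p ≠ 0 → f p = g p) : arrowSum e r f = arrowSum e s g := by
  refine Finset.sum_congr rfl fun p _ => ?_
  rw [h]
  by_cases hp : s p = 0
  · simp [hp]
  · rw [h' p hp]

/-- Labels can be recovered only where the coefficient is non-zero. This lemma turns an equation in
a tensor power of H into equations between coefficients and between elements of J. -/
lemma arrowSum_inj {e : Module.Basis (X × M) ℂ A} {r s : X → ℂ} {f g : X → M}
    (h : arrowSum (fun p x => e (p, x)) r f = arrowSum (fun p x => e (p, x)) s g) (p : X) :
    r p = s p ∧ (r p ≠ 0 → f p = g p) := by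
  classical
  have key (r : X → ℂ) (f : X → M) (x : M) :
      e.repr (arrowSum (fun p x => e (p, x)) r f) (p, x) = if f p = x then r p else 0 := by
    rw [arrowSum, map_sum, Finsupp.finsetSum_apply, Finset.sum_eq_single p]
    · simp [Finsupp.single_apply]
    · intro q _ hq
      simp [hq]
    · simp
  have h1 := key r f (f p)
  rw [h, key, if_pos rfl] at h1
  have h2 := key r f (g p)
  rw [h, key, if_pos rfl] at h2
  by_cases hfg : f p = g p
  · simp [h2, hfg]
  · rw [if_neg (Ne.symm hfg)] at h1
    rw [if_neg hfg] at h2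
    simp [h2, ← h1]

end ArrowSum

section Two

variable {H : Type*} [Ring H] [HopfAlgebra ℂ H] {I J : Type*}

/-- The basis of `H ⊗ H` consisting of the tensor products of arrows, with the sources split off. -/
noncomputable def twoBasis (e : Module.Basis (I × J) ℂ H) : Module.Basis ((I × I) × (J × J)) ℂ
    (H ⊗[ℂ] H) :=
  (e.tensorProduct e).reindex (Equiv.prodProdProdComm I J I J)

lemma twoBasis_apply (e : Module.Basis (I × J) ℂ H) (p : I × I) (x : J × J) :
    twoBasis e (p, x) = e (p.1, x.1) ⊗ₜ[ℂ] e (p.2, x.2) := by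
  simp [twoBasis, Module.Basis.tensorProduct_apply]

variable [Fintype I]

/-- The element `∑ r(u, v) e(u, a(u, v)) ⊗ e(v, b(u, v))`. -/
noncomputable def two (e : Module.Basis (I × J) ℂ H) (r : I → I → ℂ) (a b : I → I → J) :
    H ⊗[ℂ] H :=
  ∑ u, ∑ v, r u v • e (u, a u v) ⊗ₜ[ℂ] e (v, b u v)

/-- The element `∑ r(u, v, w) e(u, a(u, v, w)) ⊗ (e(v, b(u, v, w)) ⊗ e(w, c(u, v, w)))`. -/
noncomputable def three (e : Module.Basis (I × J) ℂ H) (r : I → I → I → ℂ)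
    (a b c : I → I → I → J) : H ⊗[ℂ] (H ⊗[ℂ] H) :=
  ∑ u, ∑ v, ∑ w, r u v w • e (u, a u v w) ⊗ₜ[ℂ] (e (v, b u v w) ⊗ₜ[ℂ] e (w, c u v w))

variable {e : Module.Basis (I × J) ℂ H}

lemma two_eq (r : I → I → ℂ) (a b : I → I → J) : two e r a b =
    arrowSum (X := I × I) (M := J × J) (fun p x => e (p.1, x.1) ⊗ₜ[ℂ] e (p.2, x.2))
      (fun p => r p.1 p.2) (fun p => (a p.1 p.2, b p.1 p.2)) := by
  rw [two, arrowSum, Fintype.sum_prod_type]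

lemma three_eq (r : I → I → I → ℂ) (a b c : I → I → I → J) : three e r a b c =
    arrowSum (X := I × I × I) (M := J × J × J)
      (fun p x => e (p.1, x.1) ⊗ₜ[ℂ] (e (p.2.1, x.2.1) ⊗ₜ[ℂ] e (p.2.2, x.2.2)))
      (fun p => r p.1 p.2.1 p.2.2)
      (fun p => (a p.1 p.2.1 p.2.2, b p.1 p.2.1 p.2.2, c p.1 p.2.1 p.2.2)) := by
  rw [three, arrowSum, Fintype.sum_prod_type]
  exact Finset.sum_congr rfl fun u _ => by rw [Fintype.sum_prod_type]

lemma two_congr {r s : I → I → ℂ} {a b a' b' : I → I → J} (h : ∀ u v, r u v = s u v)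
    (h' : ∀ u v, s u v ≠ 0 → a u v = a' u v ∧ b u v = b' u v) :
    two e r a b = two e s a' b' := by
  rw [two_eq, two_eq]
  refine arrowSum_congr (fun p => h _ _) fun p hp => ?_
  rw [(h' _ _ hp).1, (h' _ _ hp).2]

lemma three_congr {r s : I → I → I → ℂ} {a b c a' b' c' : I → I → I → J}
    (h : ∀ u v w, r u v w = s u v w) (ha : ∀ u v w, a u v w = a' u v w)
    (hb : ∀ u v w, b u v w = b' u v w) (hc : ∀ u v w, c u v w = c' u v w) :
    three e r a b c = three e s a' b' c' := by
  simp only [three, h, ha, hb, hc]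

lemma two_inj {r s : I → I → ℂ} {a b a' b' : I → I → J} (h : two e r a b = two e s a' b')
    (u v : I) : r u v = s u v ∧ (r u v ≠ 0 → a u v = a' u v ∧ b u v = b' u v) := by
  rw [two_eq, two_eq] at h
  simp only [← twoBasis_apply] at h
  simpa using arrowSum_inj h (u, v)

lemma three_inj {r s : I → I → I → ℂ} {a b c a' b' c' : I → I → I → J}
    (h : three e r a b c = three e s a' b' c') (u v w : I) : r u v w = s u v w ∧
      (r u v w ≠ 0 → a u v w = a' u v w ∧ b u v w = b' u v w ∧ c u v w = c' u v w) := by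
  let E : Module.Basis ((I × I × I) × (J × J × J)) ℂ (H ⊗[ℂ] (H ⊗[ℂ] H)) :=
    (e.tensorProduct (e.tensorProduct e)).reindex
      (((Equiv.refl _).prodCongr (Equiv.prodProdProdComm I J I J)).trans
        (Equiv.prodProdProdComm I J (I × I) (J × J)))
  have hE (p x) : E (p, x) = e (p.1, x.1) ⊗ₜ[ℂ] (e (p.2.1, x.2.1) ⊗ₜ[ℂ] e (p.2.2, x.2.2)) := by
    simp [E, Module.Basis.tensorProduct_apply]
  rw [three_eq, three_eq] at h
  simp only [← hE] at h
  simpa using arrowSum_inj h (u, v, w)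

lemma comm_two (r : I → I → ℂ) (a b : I → I → J) :
    TensorProduct.comm ℂ H H (two e r a b) =
      two e (fun u v => r v u) (fun u v => b v u) (fun u v => a v u) := by
  simp only [two, map_sum, map_smul, TensorProduct.comm_tmul]
  exact Finset.sum_comm

variable [Group I] [Group J] [DecidableEq I] {mp : MatchedPair I J}

lemma IsBicrossedBasis.two_mul (he : IsBicrossedBasis mp e) (r s : I → I → ℂ) (a b c d : I → I → J)
    :
    two e r a b * two e s c d =
      two e (fun u v => r u v * s (mp.act u (a u v)) (mp.act v (b u v)))
        (fun u v => a u v * c (mp.act u (a u v)) (mp.act v (b u v)))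
        (fun u v => b u v * d (mp.act u (a u v)) (mp.act v (b u v))) := by
  rw [two_eq, two_eq, two_eq, arrowSum_mul (act := fun p x => (mp.act p.1 x.1, mp.act p.2 x.2))]
  · rfl
  · intro p q x y
    simp only [Algebra.TensorProduct.tmul_mul_tmul, he.mul, Prod.ext_iff]
    split_ifs <;> simp_all

lemma IsBicrossedBasis.three_mul (he : IsBicrossedBasis mp e) (r s : I → I → I → ℂ)
    (a b c a' b' c' : I → I → I → J) :
    three e r a b c * three e s a' b' c' =
      three e
        (fun u v w => r u v w *
          s (mp.act u (a u v w)) (mp.act v (b u v w)) (mp.act w (c u v w)))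
        (fun u v w => a u v w *
          a' (mp.act u (a u v w)) (mp.act v (b u v w)) (mp.act w (c u v w)))
        (fun u v w => b u v w *
          b' (mp.act u (a u v w)) (mp.act v (b u v w)) (mp.act w (c u v w)))
        (fun u v w => c u v w *
          c' (mp.act u (a u v w)) (mp.act v (b u v w)) (mp.act w (c u v w))) := by
  rw [three_eq, three_eq, three_eq, arrowSum_mul
    (act := fun p x => (mp.act p.1 x.1, mp.act p.2.1 x.2.1, mp.act p.2.2 x.2.2))]
  · rfl
  · intro p q x y
    simp only [Algebra.TensorProduct.tmul_mul_tmul, he.mul, Prod.ext_iff]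
    split_ifs <;> simp_all

lemma IsBicrossedBasis.one_eq_two (he : IsBicrossedBasis mp e) : (1 : H ⊗[ℂ] H) = two e 1 1 1 := by
  rw [Algebra.TensorProduct.one_def, he.one]
  simp only [two, TensorProduct.sum_tmul, TensorProduct.tmul_sum, Pi.one_apply, one_smul]
  exact Finset.sum_comm

lemma IsBicrossedBasis.comul_eq_two (he : IsBicrossedBasis mp e) (k : I) (x : J) : Coalgebra.comul
    (R := ℂ) (e (k, x)) =
    two e (fun u v => if u * v = k then 1 else 0) (fun _ v => mp.co v x) (fun _ _ => x) := by
  rw [he.comul, two, Finset.sum_comm]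
  refine Finset.sum_congr rfl fun v _ => ?_
  rw [Finset.sum_eq_single (k * v⁻¹)]
  · simp
  · intro u _ hu
    rw [if_neg, zero_smul]
    exact fun h => hu (eq_mul_inv_of_mul_eq h)
  · simp

lemma IsBicrossedBasis.rTensor_comul_two (he : IsBicrossedBasis mp e) (r : I → I → ℂ)
    (a b : I → I → J) :
    TensorProduct.assoc ℂ H H H (Coalgebra.comul.rTensor H (two e r a b)) =
      three e (fun u v w => r (u * v) w) (fun u v w => mp.co v (a (u * v) w))
        (fun u v w => a (u * v) w) (fun u v w => b (u * v) w) := by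
  simp only [two, three, map_sum, map_smul, LinearMap.rTensor_tmul, he.comul,
    TensorProduct.sum_tmul, TensorProduct.assoc_tmul, Finset.smul_sum]
  conv_rhs => enter [2, u]; rw [Finset.sum_comm]
  rw [Finset.sum_comm]
  conv_rhs => rw [Finset.sum_comm]
  refine Finset.sum_congr rfl fun w _ => ?_
  rw [Finset.sum_comm]
  conv_rhs => rw [Finset.sum_comm]
  refine Finset.sum_congr rfl fun v _ => ?_
  refine (Fintype.sum_equiv (Equiv.mulRight v) _ _ fun u => ?_).symm
  simp

lemma IsBicrossedBasis.lTensor_comul_two (he : IsBicrossedBasis mp e) (r : I → I → ℂ)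
    (a b : I → I → J) :
    Coalgebra.comul.lTensor H (two e r a b) =
      three e (fun u v w => r u (v * w)) (fun u v w => a u (v * w))
        (fun u v w => mp.co w (b u (v * w))) (fun u v w => b u (v * w)) := by
  simp only [two, three, map_sum, map_smul, LinearMap.lTensor_tmul, he.comul,
    TensorProduct.tmul_sum, Finset.smul_sum]
  refine Finset.sum_congr rfl fun u _ => ?_
  rw [Finset.sum_comm]
  conv_rhs => rw [Finset.sum_comm]
  refine Finset.sum_congr rfl fun w _ => ?_
  refine (Fintype.sum_equiv (Equiv.mulRight w) _ _ fun v => ?_).symm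
  simp

lemma IsBicrossedBasis.two_thirteen (he : IsBicrossedBasis mp e) (r : I → I → ℂ) (a b : I → I → J) :
    (Algebra.TensorProduct.includeRight (R := ℂ) (A := H) (B := H)).toLinearMap.lTensor H
      (two e r a b) =
      three e (fun u _ w => r u w) (fun u _ w => a u w) 1 (fun u _ w => b u w) := by
  simp only [two, three, map_sum, map_smul, LinearMap.lTensor_tmul, AlgHom.toLinearMap_apply,
    Algebra.TensorProduct.includeRight_apply, he.one, TensorProduct.tmul_sum,
    TensorProduct.sum_tmul, Finset.smul_sum]
  exact Finset.sum_congr rfl fun u _ => Finset.sum_comm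

lemma IsBicrossedBasis.one_tmul_two (he : IsBicrossedBasis mp e) (r : I → I → ℂ) (a b : I → I → J) :
    (1 : H) ⊗ₜ[ℂ] two e r a b =
      three e (fun _ v w => r v w) 1 (fun _ v w => a v w) (fun _ v w => b v w) := by
  simp only [two, three, he.one, TensorProduct.tmul_sum, TensorProduct.sum_tmul,
    TensorProduct.tmul_smul, Pi.one_apply, Finset.smul_sum]
  conv_rhs => rw [Finset.sum_comm]
  exact Finset.sum_congr rfl fun u _ => Finset.sum_comm

lemma IsBicrossedBasis.assoc_two_tmul_one (he : IsBicrossedBasis mp e) (r : I → I → ℂ)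
    (a b : I → I → J) :
    TensorProduct.assoc ℂ H H H (two e r a b ⊗ₜ[ℂ] (1 : H)) =
      three e (fun u v _ => r u v) (fun u v _ => a u v) (fun u v _ => b u v) 1 := by
  simp only [two, three, he.one, TensorProduct.tmul_sum, TensorProduct.sum_tmul, map_sum,
    ← TensorProduct.smul_tmul', map_smul, TensorProduct.assoc_tmul, Pi.one_apply]
  rw [Finset.sum_comm]
  exact Finset.sum_congr rfl fun u _ => Finset.sum_comm

lemma IsBicrossedBasis.lid_counit_two (he : IsBicrossedBasis mp e) (r : I → I → ℂ)
    (a b : I → I → J) :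
    TensorProduct.lid ℂ H (Coalgebra.counit.rTensor H (two e r a b)) =
      ∑ v, r 1 v • e (v, b 1 v) := by
  simp only [two, map_sum, map_smul, LinearMap.rTensor_tmul, he.counit, TensorProduct.lid_tmul]
  rw [Finset.sum_comm]
  simp

lemma IsBicrossedBasis.rid_counit_two (he : IsBicrossedBasis mp e) (r : I → I → ℂ)
    (a b : I → I → J) :
    TensorProduct.rid ℂ H (Coalgebra.counit.lTensor H (two e r a b)) =
      ∑ u, r u 1 • e (u, a u 1) := by
  simp only [two, map_sum, map_smul, LinearMap.lTensor_tmul, he.counit, TensorProduct.rid_tmul]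
  simp

end Two

/-! ### Non-negative invertible elements -/

section Inverse

variable {H : Type*} [Ring H] [HopfAlgebra ℂ H]

/-- Apply a ⊗ b ⊗ c ↦ a S(b) ⊗ c to (Δ ⊗ id)R = R₁₃R₂₃: the left side collapses to 1 by the antipode
and counit axioms, the right side to R · (S ⊗ id)R. -/
lemma IsQuasiTriangular.mul_antipode {R : H ⊗[ℂ] H} (hR : IsQuasiTriangular R) :
    R * (HopfAlgebra.antipode ℂ).rTensor H R = 1 := by
  let Θ : H ⊗[ℂ] (H ⊗[ℂ] H) →ₗ[ℂ] H ⊗[ℂ] H :=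
    (LinearMap.mul' ℂ H ∘ₗ (HopfAlgebra.antipode ℂ).lTensor H).rTensor H ∘ₗ
      (TensorProduct.assoc ℂ H H H).symm.toLinearMap
  have h1 := congrArg Θ hR.comul_rTensor
  have h2 (S : H ⊗[ℂ] H) : Θ (TensorProduct.assoc ℂ H H H (Coalgebra.comul.rTensor H S)) =
      1 ⊗ₜ[ℂ] TensorProduct.lid ℂ H (Coalgebra.counit.rTensor H S) := by
    induction S with
    | zero => simp
    | add x y hx hy => simp only [map_add, hx, hy, TensorProduct.tmul_add]
    | tmul x y =>
      have := HopfAlgebra.mul_antipode_lTensor_comul_apply (R := ℂ) x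
      simp only [Θ, LinearMap.comp_apply, LinearEquiv.coe_coe, LinearEquiv.symm_apply_apply,
        LinearMap.rTensor_tmul, this, TensorProduct.lid_tmul, Algebra.algebraMap_eq_smul_one,
        TensorProduct.smul_tmul]
  have h3 (S S' : H ⊗[ℂ] H) :
      Θ ((Algebra.TensorProduct.includeRight (R := ℂ) (A := H) (B := H)).toLinearMap.lTensor H S *
        (1 : H) ⊗ₜ[ℂ] S') = S * (HopfAlgebra.antipode ℂ).rTensor H S' := by
    induction S with
    | zero => simp
    | add x y hx hy => simp only [map_add, add_mul, hx, hy]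
    | tmul x y =>
      induction S' with
      | zero => simp
      | add x y hx hy => simp only [map_add, mul_add, TensorProduct.tmul_add, hx, hy]
      | tmul z w => simp [Θ]
  rw [h2, h3, hR.counit_rTensor] at h1
  exact h1.symm

/-- Positive rescaling and relabelling of a basis preserve non-negativity of coordinates, so
positivity passes to the normalised basis. -/
lemma repr_nonneg_of_smul {V ι κ : Type*} [AddCommGroup V] [Module ℂ V] {b : Module.Basis ι ℂ V}
    {e : Module.Basis κ ℂ V} (f : κ ≃ ι) {l : κ → ℝ} (hl : ∀ p, 0 < l p)
    (he : ∀ p, e p = (l p : ℂ) • b (f p)) {a : V} (ha : ∀ i, 0 ≤ b.repr a i) (p : κ) :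
    0 ≤ e.repr a p := by
  have key : b.repr a (f p) = l p * e.repr a p := by
    have : (b.coord (f p)) = (l p : ℂ) • e.coord p := by
      refine e.ext fun q => ?_
      rw [Module.Basis.coord_apply, LinearMap.smul_apply, Module.Basis.coord_apply,
        Module.Basis.repr_self, he q, map_smul, Module.Basis.repr_self]
      by_cases hq : q = p
      · subst hq
        simp only [Finsupp.smul_apply, Finsupp.single_eq_same]
      · have : f q ≠ f p := fun h => hq (f.injective h)
        simp only [Finsupp.smul_apply, Finsupp.single_eq_of_ne (Ne.symm this),
          Finsupp.single_eq_of_ne (Ne.symm hq), smul_zero]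
    exact congr($this a)
  have hl' : (l p : ℂ) ≠ 0 := by exact_mod_cast (hl p).ne'
  rw [eq_div_of_mul_eq hl' ((mul_comm _ _).trans key.symm), div_eq_mul_inv]
  refine mul_nonneg (ha _) ?_
  rw [← Complex.ofReal_inv]
  exact Complex.zero_le_real.2 (inv_nonneg.2 (hl p).le)

end Inverse

section Bisection

variable {X M A : Type*} [Fintype X] [DecidableEq X] [Fintype M] [Group M] [Ring A] [Algebra ℂ A]
  {E : Module.Basis (X × M) ℂ A} {act : X → M → X}

lemma repr_mul_of_arrows (he : ∀ p q x y, E (p, x) * E (q, y) = if act p x = q then E (p, x * y)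
    else 0)
    (a a' : A) (p : X) (x : M) :
    E.repr (a * a') (p, x) = ∑ g, E.repr a (p, g) * E.repr a' (act p g, g⁻¹ * x) := by
  classical
  conv_lhs => rw [← E.sum_repr a, ← E.sum_repr a', Fintype.sum_prod_type, Fintype.sum_prod_type]
  simp_rw [Finset.sum_mul, Finset.mul_sum, smul_mul_smul_comm, he, map_sum,
    Finsupp.finsetSum_apply, map_smul, Finsupp.smul_apply]
  rw [Finset.sum_eq_single p]
  · refine Finset.sum_congr rfl fun g _ => ?_
    rw [Finset.sum_eq_single (act p g), Finset.sum_eq_single (g⁻¹ * x)]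
    · simp
    · intro y _ hy
      have : g * y ≠ x := fun h => hy (eq_inv_mul_of_mul_eq h)
      simp [this]
    · simp
    · intro q _ hq
      simp [hq.symm]
    · simp
  · intro q _ hq
    refine Finset.sum_eq_zero fun g _ => Finset.sum_eq_zero fun p' _ =>
      Finset.sum_eq_zero fun y _ => ?_
    split_ifs <;> simp [hq]
  · simp

lemma exists_arrowSum_of_mul_eq_one
    (he : ∀ p q x y, E (p, x) * E (q, y) = if act p x = q then E (p, x * y) else 0)
    (hact : ∀ p x y, act p (x * y) = act (act p x) y) (hone : ∀ p, act p 1 = p)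
    (h1 : 1 = ∑ p, E (p, 1)) {a a' : A} (ha : ∀ p, 0 ≤ E.repr a p) (ha' : ∀ p, 0 ≤ E.repr a' p)
    (h : a * a' = 1) (h' : a' * a = 1) :
    ∃ (r : X → ℝ) (f : X → M), (∀ p, 0 < r p) ∧
      a = arrowSum (fun p x => E (p, x)) (fun p => (r p : ℂ)) f := by
  classical
  have hrep (p : X) (x : M) : E.repr 1 (p, x) = if x = 1 then 1 else 0 := by
    rw [h1, map_sum, Finsupp.finsetSum_apply, Finset.sum_eq_single p]
    · simp [Finsupp.single_apply, eq_comm]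
    · intro q _ hq
      simp [hq]
    · simp
  -- The coefficient of the identity arrow at `p` in `a * a' = 1` is not zero.
  have e1 (p : X) : ∃ g, E.repr a (p, g) ≠ 0 ∧ E.repr a' (act p g, g⁻¹) ≠ 0 := by
    have := repr_mul_of_arrows he a a' p 1
    rw [h, hrep, if_pos rfl] at this
    obtain ⟨g, -, hg⟩ := Finset.exists_ne_zero_of_sum_ne_zero (this ▸ one_ne_zero)
    rw [mul_one] at hg
    exact ⟨g, left_ne_zero_of_mul hg, right_ne_zero_of_mul hg⟩
  choose f hf hf' using e1
  -- A second arrow `k` of `a` at `p`, preceded by the arrow `(f p)⁻¹` of `a'`, would give a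
  -- non-identity arrow with positive coefficient in `a' * a = 1`.
  have e2 (p : X) (k : M) (hk : k ≠ f p) : E.repr a (p, k) = 0 := by
    have := repr_mul_of_arrows he a' a (act p (f p)) ((f p)⁻¹ * k)
    rw [h', hrep, if_neg (by rwa [inv_mul_eq_one, eq_comm]), eq_comm,
      Finset.sum_eq_zero_iff_of_nonneg fun _ _ => mul_nonneg (ha' _) (ha _)] at this
    have := this (f p)⁻¹ (Finset.mem_univ _)
    rw [← hact, mul_inv_cancel, hone, inv_inv, mul_inv_cancel_left] at this
    exact (mul_eq_zero.1 this).resolve_left (hf' p)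
  have e3 (p : X) (k : M) : E.repr a (p, k) = ((E.repr a (p, k)).re : ℂ) :=
    Complex.eq_re_of_ofReal_le (r := 0) (by simpa using ha (p, k))
  refine ⟨fun p => (E.repr a (p, f p)).re, f, fun p => ?_, ?_⟩
  · refine (Complex.nonneg_iff.1 (ha _)).1.lt_of_ne' fun h0 => hf p ?_
    rw [e3, h0, Complex.ofReal_zero]
  · conv_lhs => rw [← E.sum_repr a, Fintype.sum_prod_type]
    refine Finset.sum_congr rfl fun p _ => ?_
    rw [Finset.sum_eq_single (f p)]
    · exact congrArg (· • E (p, f p)) (e3 p (f p))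
    · intro k _ hk
      rw [e2 p k hk, zero_smul]
    · simp

end Bisection

/-! ### Positive quasi-triangular structures on a bicrossproduct -/

section Classification

variable {I J : Type*} [Group I] [Group J]

/-- The relations satisfied by the components `A : I → I → J`, `ξ : I → J` of a positive
quasi-triangular structure `∑ e(u, A(u, v)) ⊗ e(v, ξ(u))`. -/
structure IsBraiding (mp : MatchedPair I J) (A : I → I → J) (ξ : I →* J) : Prop where
  map_mul (u c d : I) : A u (c * d) = A u d * A (mp.act u (A u d)) c
  mul_map (c d v : I) : A (c * d) v = A d (mp.act v (ξ c))
  braid (u v : I) : v * u = mp.act u (A u v) * mp.act v (ξ u)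
  mul_right (u : I) (x : J) : ξ u * x = mp.co u x * ξ (mp.act u x)
  mul_left (v : I) (x : J) : A 1 v * mp.co v x = x * A 1 (mp.act v x)

/-- Multiplying `h2` over `v` shows that `c ↦ ∏ v, r c v` is a positive character of a finite group,
hence trivial. Multiplying `h1` over `c` then gives `r u v ^ |I| = 1`. -/
lemma eq_one_of_cocycle [Fintype I] (mp : MatchedPair I J) {r : I → I → ℝ}
    (hr : ∀ u v, 0 < r u v) {A : I → I → J} {ξ : I → J}
    (h1 : ∀ u c d, r u (c * d) = r u d * r (mp.act u (A u d)) c)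
    (h2 : ∀ c d v, r (c * d) v = r c v * r d (mp.act v (ξ c))) (u v : I) : r u v = 1 := by
  have hone {z : ℝ} (hz : 0 < z) (h : z ^ Fintype.card I = 1) : z = 1 :=
    (pow_eq_one_iff_of_nonneg hz.le Fintype.card_ne_zero).1 h
  have hmul (c d : I) : ∏ v, r (c * d) v = (∏ v, r c v) * ∏ v, r d v := by
    simp only [h2, Finset.prod_mul_distrib]
    congr 1
    exact (mp.actEquiv (ξ c)).prod_comp (fun v => r d v)
  have hpos (c : I) : 0 < ∏ v, r c v := Finset.prod_pos fun v _ => hr _ _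
  let P : I →* ℝ :=
    { toFun := fun c => ∏ v, r c v
      map_one' := mul_left_cancel₀ (hpos 1).ne' (by rw [← hmul, one_mul, mul_one])
      map_mul' := hmul }
  have hP (c : I) : ∏ v, r c v = 1 := by
    have : P c ^ Fintype.card I = 1 := by rw [← map_pow, pow_card_eq_one, map_one]
    exact hone (hpos c) this
  have h3 : ∏ c, r u (c * v) = ∏ c, r u c := Equiv.prod_comp (Equiv.mulRight v) (fun c => r u c)
  simp only [h1, Finset.prod_mul_distrib, hP, Finset.prod_const, Finset.card_univ, mul_one] at h3
  exact hone (hr u v) h3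

variable {H : Type*} [Ring H] [HopfAlgebra ℂ H] [Fintype I] [DecidableEq I]
  {mp : MatchedPair I J} {e : Module.Basis (I × J) ℂ H}

theorem IsBicrossedBasis.exists_isBraiding [Fintype J] (he : IsBicrossedBasis mp e)
    (hS : ∀ p q, 0 ≤ e.repr (HopfAlgebra.antipode ℂ (e p)) q) {R : H ⊗[ℂ] H}
    (hR : IsQuasiTriangular R) (hpos : IsPositive e R) :
    ∃ (A : I → I → J) (ξ : I →* J), IsBraiding mp A ξ ∧ R = two e 1 A (fun u _ => ξ u) := by
  classical
  obtain ⟨r', f, hr', hRf⟩ : ∃ (r : I × I → ℝ) (f : I × I → J × J), (∀ p, 0 < r p) ∧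
      R = arrowSum (fun p x => twoBasis e (p, x)) (fun p => (r p : ℂ)) f := by
    have hinv := hR.mul_antipode
    refine exists_arrowSum_of_mul_eq_one (a' := (HopfAlgebra.antipode ℂ).rTensor H R)
      (act := fun p x => (mp.act p.1 x.1, mp.act p.2 x.2)) ?_ ?_ ?_ ?_ ?_ ?_ hinv ?_
    · intro p q x y
      simp only [twoBasis_apply, Algebra.TensorProduct.tmul_mul_tmul, he.mul, Prod.ext_iff]
      split_ifs <;> simp_all
    · simp [mp.act_mul]
    · simp [mp.act_one]
    · simp [he.one_eq_two, two_eq, arrowSum, twoBasis_apply]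
    · exact fun p => by simpa [twoBasis] using hpos _ _
    · rintro ⟨p, x⟩
      rw [← (e.tensorProduct e).sum_repr R]
      simp only [twoBasis, map_sum, map_smul, Module.Basis.repr_reindex_apply,
        Finsupp.finsetSum_apply, Finsupp.smul_apply, smul_eq_mul]
      refine Finset.sum_nonneg fun q _ => mul_nonneg (hpos _ _) ?_
      rw [Module.Basis.tensorProduct_apply, LinearMap.rTensor_tmul,
        Module.Basis.tensorProduct_repr_tmul_apply, Module.Basis.repr_self, smul_eq_mul]
      refine mul_nonneg ?_ (hS _ _)
      rw [Finsupp.single_apply]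
      split_ifs <;> simp
    · refine hR.isUnit.mul_left_cancel ?_
      rw [← mul_assoc, hinv, one_mul, mul_one]
  obtain ⟨r, hr⟩ : ∃ r : I → I → ℝ, ∀ u v, r u v = r' (u, v) := ⟨_, fun _ _ => rfl⟩
  obtain ⟨a, ha⟩ : ∃ a : I → I → J, ∀ u v, a u v = (f (u, v)).1 := ⟨_, fun _ _ => rfl⟩
  obtain ⟨b, hb⟩ : ∃ b : I → I → J, ∀ u v, b u v = (f (u, v)).2 := ⟨_, fun _ _ => rfl⟩
  have hr0 (u v : I) : 0 < r u v := hr u v ▸ hr' _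
  have hr0' (u v : I) : (r u v : ℂ) ≠ 0 := by exact_mod_cast (hr0 u v).ne'
  have hRt : R = two e (fun u v => (r u v : ℂ)) a b := by
    simp only [hRf, two_eq, hr, ha, hb, twoBasis_apply]
  have hl := hR.comul_lTensor
  rw [hRt, he.lTensor_comul_two, he.two_thirteen, he.assoc_two_tmul_one, he.three_mul] at hl
  have hl (u c d : I) := three_inj hl u c d
  simp only [Pi.one_apply, mp.act_one, one_mul, mul_one] at hl
  have hl1 (u c d : I) : r u (c * d) = r u d * r (mp.act u (a u d)) c := by
    exact_mod_cast (hl u c d).1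
  have hl2 (u c d : I) := (hl u c d).2 (hr0' _ _)
  have hd := hR.comul_rTensor
  rw [hRt, he.rTensor_comul_two, he.two_thirteen, he.one_tmul_two, he.three_mul] at hd
  have hd (c d v : I) := three_inj hd c d v
  simp only [Pi.one_apply, mp.act_one, one_mul, mul_one] at hd
  have hd1 (c d v : I) : r (c * d) v = r c v * r d (mp.act v (b c v)) := by
    exact_mod_cast (hd c d v).1
  have hd2 (c d v : I) := (hd c d v).2 (hr0' _ _)
  -- The third leg of (id ⊗ Δ)R = R₁₃R₁₂ gives b(u, cd) = b(u, d); take d = 1.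
  have hb1 (u v : I) : b u v = b u 1 := by simpa using (hl2 u v 1).2.2
  let ξ : I →* J := MonoidHom.mk' (fun u => b u 1) fun c d => by
    rw [(hd2 c d 1).2.2, hb1 d]
  have hξ (u v : I) : b u v = ξ u := hb1 u v
  simp only [hξ] at hd1 hl2 hd2
  have hr1 : r = 1 := by
    ext u v
    exact eq_one_of_cocycle mp hr0 hl1 hd1 u v
  have hRt' : R = two e 1 a (fun u _ => ξ u) := by
    rw [hRt]
    exact two_congr (fun u v => by simp [hr1]) fun u v _ => ⟨rfl, hξ u v⟩
  -- The source `v * u` is chosen so that u ⊗ v occurs in its opposite coproduct; its coefficient on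
  -- the other side must then also be 1, which is the braid relation.
  have hc (u v : I) (x : J) : mp.act u (a u v) * mp.act v (ξ u) = v * u ∧
      x * a (mp.act u x) (mp.act v (mp.co u x)) = a u v * mp.co (mp.act v (ξ u)) x ∧
      mp.co u x * ξ (mp.act u x) = ξ u * x := by
    have := hR.comm_comul (e (v * u, x))
    rw [hRt', he.comul_eq_two, comm_two, he.two_mul, he.two_mul] at this
    have := two_inj this u v
    simp only [Pi.one_apply, if_true, mul_one, one_mul, ne_eq, one_ne_zero, not_false_eq_true,
      true_imp_iff] at this
    refine ⟨?_, this.2⟩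
    by_contra hne
    rw [if_neg hne] at this
    exact one_ne_zero this.1
  refine ⟨a, ξ, ⟨fun u c d => (hl2 u c d).1, fun c d v => (hd2 c d v).2.1,
    fun u v => (hc u v 1).1.symm, fun u x => (hc u 1 x).2.2.symm, fun v x => ?_⟩, hRt'⟩
  have := (hc 1 v x).2.1
  rw [mp.one_act, mp.one_co, map_one, mp.act_one] at this
  exact this.symm

end Classification

/-! ### The factorizable group and its retractions -/

namespace MatchedPair

variable {I J : Type*} [Group I] [Group J] (mp : MatchedPair I J)

/-- The group `J I` factorized by a matched pair; `⟨x, i⟩` stands for `x i`. -/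
@[ext]
structure Product (mp : MatchedPair I J) where
  fst : J
  snd : I

namespace Product

instance [Finite I] [Finite J] : Finite mp.Product :=
  Finite.of_injective (fun g => (g.fst, g.snd)) fun _ _ h =>
    Product.ext (congrArg Prod.fst h) (congrArg Prod.snd h)

variable {mp}

instance : Mul mp.Product := ⟨fun g k => ⟨g.fst * mp.co g.snd k.fst, mp.act g.snd k.fst * k.snd⟩⟩

instance : One mp.Product := ⟨⟨1, 1⟩⟩

instance : Inv mp.Product :=
  ⟨fun g => ⟨mp.co g.snd⁻¹ g.fst⁻¹, mp.act g.snd⁻¹ g.fst⁻¹⟩⟩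

@[simp] lemma fst_mul (g k : mp.Product) : (g * k).fst = g.fst * mp.co g.snd k.fst := rfl

@[simp] lemma snd_mul (g k : mp.Product) : (g * k).snd = mp.act g.snd k.fst * k.snd := rfl

@[simp] lemma fst_one : (1 : mp.Product).fst = 1 := rfl

@[simp] lemma snd_one : (1 : mp.Product).snd = 1 := rfl

@[simp] lemma fst_inv (g : mp.Product) : g⁻¹.fst = mp.co g.snd⁻¹ g.fst⁻¹ := rfl

@[simp] lemma snd_inv (g : mp.Product) : g⁻¹.snd = mp.act g.snd⁻¹ g.fst⁻¹ := rfl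

instance : Group mp.Product := Group.ofLeftAxioms
  (fun g k l => by ext <;> simp [mp.mul_co, mp.co_mul, mp.mul_act, mp.act_mul, mul_assoc])
  (fun g => by ext <;> simp [mp.one_co, mp.one_act])
  (fun g => by
    ext
    · simp [← mp.co_mul, mp.co_one]
    · simp [← mp.act_mul, mp.act_one])

end Product

/-- The inclusion of `I` in the product group. -/
def inl : I →* mp.Product := MonoidHom.mk' (fun i => ⟨1, i⟩) fun i j => by
  ext <;> simp [mp.co_one, mp.act_one]

/-- The inclusion of `J` in the product group. -/
def inr : J →* mp.Product := MonoidHom.mk' (fun x => ⟨x, 1⟩) fun x y => by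
  ext <;> simp [mp.one_co, mp.one_act]

variable {mp}

@[simp] lemma fst_inl (i : I) : (mp.inl i).fst = 1 := rfl

@[simp] lemma snd_inl (i : I) : (mp.inl i).snd = i := rfl

@[simp] lemma fst_inr (x : J) : (mp.inr x).fst = x := rfl

@[simp] lemma snd_inr (x : J) : (mp.inr x).snd = 1 := rfl

lemma inr_mul_inl (x : J) (i : I) : mp.inr x * mp.inl i = ⟨x, i⟩ := by
  ext <;> simp [mp.co_one, mp.act_one]

lemma inl_mul_inr (x : J) (i : I) :
    mp.inl i * mp.inr x = mp.inr (mp.co i x) * mp.inl (mp.act i x) := by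
  rw [inr_mul_inl]
  ext <;> simp

/-- A homomorphism `ξ : I →* J` with `ξ(i) x = (i ▷ x) ξ(i ◁ x)` extends to a retraction of the
product group onto `J`. -/
def retraction (ξ : I →* J) (hξ : ∀ i x, ξ i * x = mp.co i x * ξ (mp.act i x)) :
    mp.Product →* J := MonoidHom.mk' (fun g => g.fst * ξ g.snd) fun g k => by
  rw [Product.fst_mul, Product.snd_mul, map_mul, mul_assoc, ← mul_assoc (mp.co _ _), ← hξ]
  simp only [mul_assoc]

section

variable (ξ : I →* J) (hξ : ∀ i x, ξ i * x = mp.co i x * ξ (mp.act i x))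

@[simp] lemma retraction_inl (i : I) : retraction ξ hξ (mp.inl i) = ξ i := one_mul _

@[simp] lemma retraction_inr (x : J) : retraction ξ hξ (mp.inr x) = x := by
  change x * ξ 1 = x
  rw [map_one, mul_one]

variable (mp) in
/-- The element `ξ(i)⁻¹ i` of the product group. -/
def graph (i : I) : mp.Product := mp.inr (ξ i)⁻¹ * mp.inl i

lemma graph_mem (i : I) : mp.graph ξ i ∈ (retraction ξ hξ).ker := by
  simp [MonoidHom.mem_ker, graph]

/-- The kernel of the retraction is parametrized by `I`. -/
def graphEquiv : I ≃ (retraction ξ hξ).ker where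
  toFun i := ⟨mp.graph ξ i, graph_mem ξ hξ i⟩
  invFun g := g.1.snd
  left_inv i := by
    dsimp only [graph]
    rw [inr_mul_inl]
  right_inv g := by
    obtain ⟨⟨x, i⟩, hg⟩ := g
    have hg' : x * ξ i = 1 := hg
    apply Subtype.ext
    dsimp only [graph]
    rw [inr_mul_inl, eq_inv_of_mul_eq_one_left hg']

variable {ξ}

-- Under the parametrization of the kernel by I, conjugation by J becomes the original right action.
include hξ in
lemma graph_act (i : I) (x : J) :
    mp.graph ξ (mp.act i x) = (mp.inr x)⁻¹ * mp.graph ξ i * mp.inr x := by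
  rw [graph, graph, mul_assoc, mul_assoc, inl_mul_inr, ← mul_assoc, ← mul_assoc, ← map_inv mp.inr,
    ← map_mul mp.inr, ← map_mul mp.inr]
  congr 2
  rw [eq_mul_inv_of_mul_eq (hξ i x).symm]
  group

-- The group law of the kernel, transported to I, is (i ◁ ξ(j)⁻¹) j. The twisted comultiplication is
-- dual to this law.
include hξ in
lemma graph_mul (i j : I) :
    mp.graph ξ i * mp.graph ξ j = mp.graph ξ (mp.act i (ξ j)⁻¹ * j) := by
  have h1 := graph_act hξ i (ξ j)⁻¹
  have h2 : mp.graph ξ i * mp.inr (ξ j)⁻¹ = mp.inr (ξ j)⁻¹ * mp.graph ξ (mp.act i (ξ j)⁻¹) := by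
    rw [h1]
    group
  rw [graph.eq_1 mp ξ j, ← mul_assoc, h2, graph, graph, map_mul, map_mul, mul_inv_rev, map_mul]
  simp only [mul_assoc]

end

end MatchedPair

/-! ### Normal structures on semidirect factorizations -/

lemma isComplement_ker_range {G J : Type*} [Group G] [Group J] (ρ : G →* J) (s : J →* G)
    (h : ∀ x, ρ (s x) = x) : ρ.ker.IsComplement' s.range := by
  refine Subgroup.isComplement'_of_disjoint_and_mul_eq_univ ?_ ?_
  · rw [Subgroup.disjoint_def]
    rintro _ hx ⟨x, rfl⟩
    rw [MonoidHom.mem_ker, h] at hx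
    rw [hx, map_one]
  · refine Set.eq_univ_of_forall fun g => ⟨g * (s (ρ g))⁻¹, ?_, s (ρ g), ⟨_, rfl⟩, by group⟩
    simp [MonoidHom.mem_ker, h]

section Semidirect

variable {G : Type*} [Group G] {P N : Subgroup G} (hPN : P.IsComplement' N) [hP : P.Normal]

/-- The matched pair of a factorization `G = P N` with `P` normal. -/
def semidirectPair (P N : Subgroup G) [hP : P.Normal] : MatchedPair P N where
  act u x := ⟨(x : G)⁻¹ * u * x, hP.conj_mem' _ u.2 _⟩
  co _ x := x
  act_one u := by simp
  act_mul u x y := by ext; simp [mul_assoc]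
  one_act x := by simp
  mul_act u v x := by ext; simp [mul_assoc]
  one_co _ := rfl
  mul_co _ _ _ := rfl
  co_one _ := rfl
  co_mul _ _ _ := rfl

lemma semidirectPair_act (u : P) (x : N) :
    ((semidirectPair P N).act u x : G) = (x : G)⁻¹ * u * x := rfl

lemma barPlus_mul_of_normal {u x : G} (hu : u ∈ P) (hx : x ∈ N) :
    barPlus hPN (u * x) = x⁻¹ * u * x := by
  have : u * x = x * (x⁻¹ * u * x) := by group
  rw [this, barPlus_of_mem_mul hPN hx, barPlus_of_mem hPN (hP.conj_mem' _ hu _)]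

lemma minus_mul_of_normal {u x : G} (hu : u ∈ P) (hx : x ∈ N) : minus hPN (x * u) = x := by
  have : x * u = (x * u * x⁻¹) * x := by group
  rw [this]
  exact (plus_minus_unique hPN (hP.conj_mem _ hu _) hx).2

/-- The basis of `H(G; P, N)` indexed by `P × N`. -/
noncomputable def BicrossedHopf.pairBasis : Module.Basis (P × N) ℂ (BicrossedHopf hPN) :=
  (BicrossedHopf.basis hPN).reindex (Subgroup.IsComplement.equiv hPN)

omit hP in
lemma BicrossedHopf.pairBasis_apply (u : P) (x : N) :
    BicrossedHopf.pairBasis hPN (u, x) = BicrossedHopf.of hPN (u * x) := by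
  rw [pairBasis, Module.Basis.reindex_apply]
  rfl

lemma BicrossedHopf.isBicrossedBasis_pairBasis [Fintype G] [Fintype P] [DecidableEq P] :
    IsBicrossedBasis (semidirectPair P N) (BicrossedHopf.pairBasis hPN) := by
  classical
  have := Fintype.ofFinite N
  refine isBicrossedBasis_of_mul_of_comul (fun u v x y => ?_) (fun u x => ?_)
  · simp only [pairBasis_apply, of_mul_of, barPlus_mul_of_normal hPN u.2 x.2,
      (plus_minus_unique hPN v.2 y.2).1, (plus_minus_unique hPN v.2 y.2).2, Subtype.ext_iff,
      semidirectPair_act, Subgroup.coe_mul, mul_assoc]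
  · simp only [pairBasis_apply, comul_of, (plus_minus_unique hPN u.2 x.2).2]
    refine Finset.sum_congr (by ext; simp) fun h _ => ?_
    rw [barPlus_mul_of_normal hPN h.2 x.2]
    congr 2
    rw [show (semidirectPair P N).co h x = x from rfl]
    push_cast
    group

end Semidirect

section NormalStructure

variable {H : Type*} [Ring H] [HopfAlgebra ℂ H] {I J : Type*} [Group I] [Group J] [Fintype I]
  [DecidableEq I] {mp : MatchedPair I J} {e : Module.Basis (I × J) ℂ H}

/-- Multiplicativity of `η` gives the hexagon identities; its equivariance and the Peiffer-type
identity `hpf` give compatibility with the opposite coproduct. -/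
lemma IsBicrossedBasis.isQuasiTriangular_two (he : IsBicrossedBasis mp e)
    (hco : ∀ u x, mp.co u x = x) (η : I →* J) (hη : ∀ v x, x * η (mp.act v x) = η v * x)
    (hpf : ∀ u v, mp.act u (η v)⁻¹ * v = v * u) :
    IsQuasiTriangular (two e 1 (fun _ v => (η v)⁻¹) 1) where
  isUnit := by
    refine isUnit_iff_exists.2 ⟨two e 1 (fun _ v => η v) 1, ?_, ?_⟩ <;>
    · rw [he.two_mul, he.one_eq_two]
      exact two_congr (fun _ _ => by simp) fun _ _ _ => by simp [mp.act_one]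
  comm_comul a := by
    have : (LinearMap.mulRight ℂ (two e 1 (fun _ v => (η v)⁻¹) 1)) ∘ₗ
        (TensorProduct.comm ℂ H H).toLinearMap ∘ₗ Coalgebra.comul =
        LinearMap.mulLeft ℂ (two e 1 (fun _ v => (η v)⁻¹) 1) ∘ₗ Coalgebra.comul := by
      refine e.ext fun ⟨w, x⟩ => ?_
      simp only [LinearMap.comp_apply, LinearMap.mulRight_apply, LinearMap.mulLeft_apply,
        LinearEquiv.coe_coe]
      rw [he.comul_eq_two, comm_two, he.two_mul, he.two_mul]
      refine two_congr (fun u v => ?_) fun u v _ => ?_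
      · simp [mp.act_one, hpf]
      · simp only [hco, Pi.one_apply, one_mul, mul_one, and_true]
        rw [mul_inv_eq_iff_eq_mul, mul_assoc, hη, inv_mul_cancel_left]
    exact congr($this a)
  comul_rTensor := by
    rw [he.rTensor_comul_two, he.two_thirteen, he.one_tmul_two, he.three_mul]
    exact three_congr (fun _ _ _ => by simp) (fun _ _ _ => by simp [hco])
      (fun _ _ _ => by simp [mp.act_one]) fun _ _ _ => by simp
  comul_lTensor := by
    rw [he.lTensor_comul_two, he.two_thirteen, he.assoc_two_tmul_one, he.three_mul]
    exact three_congr (fun _ _ _ => by simp) (fun _ _ _ => by simp [mp.act_one])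
      (fun _ _ _ => by simp [hco]) fun _ _ _ => by simp
  counit_rTensor := by
    rw [he.lid_counit_two, he.one]
    simp
  counit_lTensor := by
    rw [he.rid_counit_two, he.one]
    simp

end NormalStructure

section Crossed

variable {G : Type*} [Group G] {P N : Subgroup G} (hPN : P.IsComplement' N) [hP : P.Normal]
  (ρ : G →* N) (hρ : ∀ x : N, ρ x = x) (hcomm : ∀ u ∈ P, ∀ z ∈ ρ.ker, z * u = u * z)

-- Both `P` and `ρ.ker` are normal complements of `N`, and u ↦ ρ(u)u⁻¹ identifies them as sets; it
-- is multiplicative because the two subgroups commute.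
include hPN hρ hcomm in
lemma isAdmissible_one_restrict : IsAdmissible (1 : P →* N) (ρ.comp P.subtype) := by
  have hmem (u : P) : (ρ u : G) * (u : G)⁻¹ ∈ ρ.ker := by simp [MonoidHom.mem_ker, hρ]
  have hmul (u v : P) : ((ρ (u * v : G) : G)) * ((u * v : G))⁻¹ =
      (ρ u : G) * (u : G)⁻¹ * ((ρ v : G) * (v : G)⁻¹) := by
    have := hcomm _ (P.inv_mem u.2) _ (hmem v)
    rw [mul_assoc (ρ u : G), ← this, map_mul, Subgroup.coe_mul, mul_inv_rev]
    simp only [mul_assoc]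
  let F : P →* ρ.ker := MonoidHom.mk' (fun u => ⟨(ρ u : G) * (u : G)⁻¹, hmem u⟩)
    fun u v => Subtype.ext (hmul u v)
  -- Writing g = ḡ₋ḡ₊ and applying `ρ`, which fixes `N`, forces ḡ₋ = ρ(ḡ₊)⁻¹.
  have hker (g : ρ.ker) : ∃ u : P, (ρ u⁻¹ : G) * u = g := by
    refine ⟨⟨barPlus hPN g, barPlus_mem hPN _⟩, ?_⟩
    have h1 := barMinus_mul_barPlus hPN (g : G)
    have h2 : ρ g = 1 := g.2
    rw [← h1, map_mul, hρ ⟨_, barMinus_mem hPN (g : G)⟩] at h2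
    conv_rhs => rw [← h1]
    rw [map_inv, ← eq_inv_of_mul_eq_one_left h2]
  have hF : Function.Bijective F := by
    constructor
    · intro u v huv
      have h1 : (ρ u : G) * (u : G)⁻¹ = ρ v * (v : G)⁻¹ := congrArg Subtype.val huv
      have h2 (w : P) : plus hPN ((ρ w : G) * (w : G)⁻¹)⁻¹ = w := by
        rw [mul_inv_rev, inv_inv]
        exact (plus_minus_unique hPN w.2 (N.inv_mem (ρ w).2)).1
      have h3 := h2 u
      rw [h1, h2] at h3
      exact Subtype.ext h3.symm
    · intro g
      obtain ⟨u, hu⟩ := hker g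
      exact ⟨u⁻¹, Subtype.ext (by simpa [F] using hu)⟩
  refine ⟨P, ρ.ker, ?_, ?_, hP, inferInstance, MulEquiv.ofBijective F hF, ?_⟩
  · ext g
    simp
  · ext g
    constructor
    · intro hg
      obtain ⟨u, hu⟩ := hker ⟨g, hg⟩
      exact ⟨u, by simpa using hu⟩
    · rintro ⟨u, rfl⟩
      simp [MonoidHom.mem_ker, hρ]
  · intro u a hau
    have : a = u := Subtype.ext (by simpa using hau)
    subst this
    rfl

include hρ hcomm in
theorem isNormal_two [Fintype G] [Fintype P] : IsNormal hPN
    (two (BicrossedHopf.pairBasis hPN) 1 (fun _ v => (ρ v)⁻¹) 1) := by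
  classical
  refine ⟨(BicrossedHopf.isBicrossedBasis_pairBasis hPN).isQuasiTriangular_two (fun _ _ => rfl)
    (ρ.comp P.subtype) ?_ ?_, ?_, 1, _, isAdmissible_one_restrict hPN ρ hρ hcomm, ?_,
    fun _ => rfl⟩
  · intro v x
    simp [semidirectPair_act, hρ, mul_assoc]
  -- The element ρ(v)⁻¹v lies in the kernel of `ρ`, so it commutes with u ∈ P.
  · intro u v
    have := hcomm u u.2 ((ρ v : G)⁻¹ * v) (by simp [MonoidHom.mem_ker, hρ])
    ext
    simp only [Subgroup.coe_mul, semidirectPair_act, MonoidHom.comp_apply, Subgroup.subtype_apply,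
      Subgroup.coe_inv, inv_inv]
    rw [mul_assoc, mul_assoc, ← this]
    group
  · intro g k
    simp only [two, map_sum, Finsupp.finsetSum_apply, BicrossedHopf.pairBasis_apply,
      BicrossedHopf.of]
    refine Finset.sum_nonneg fun u _ => Finset.sum_nonneg fun v _ => ?_
    simp only [Pi.one_apply, one_smul, Module.Basis.tensorProduct_repr_tmul_apply,
      Module.Basis.repr_self, Finsupp.single_apply]
    split_ifs <;> simp
  · rw [two, rMatrix]
    refine Finset.sum_congr (by ext; simp) fun u _ => Finset.sum_congr (by ext; simp) fun v _ => ?_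
    rw [BicrossedHopf.pairBasis_apply, BicrossedHopf.pairBasis_apply,
      minus_mul_of_normal hPN u.2 (SetLike.coe_mem _)]
    simp

end Crossed

/-! ### Twisting to a normal pair -/

lemma exists_algEquiv_of_bases {A B κ : Type*} [Ring A] [Ring B] [Algebra ℂ A] [Algebra ℂ B]
    (f : Module.Basis κ ℂ A) (e : Module.Basis κ ℂ B)
    (h : ∀ i j, f.equiv e (Equiv.refl κ) (f i * f j) = e i * e j) :
    ∃ φ : A ≃ₐ[ℂ] B, ∀ i, φ (f i) = e i := by
  let L := f.equiv e (Equiv.refl κ)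
  have hL (i) : L (f i) = e i := by simp [L]
  have hmul (x y : A) : L (x * y) = L x * L y := by
    have : (LinearMap.mul ℂ A).compr₂ L.toLinearMap =
        (LinearMap.mul ℂ B).compl₁₂ L.toLinearMap L.toLinearMap := by
      refine f.ext fun i => f.ext fun j => ?_
      simpa [hL] using h i j
    exact congr($this x y)
  have hone : L 1 = 1 := by
    have h1 := hmul 1 (L.symm 1)
    rwa [one_mul, LinearEquiv.apply_symm_apply, mul_one, eq_comm] at h1
  exact ⟨AlgEquiv.ofLinearEquiv L hone hmul, hL⟩

section Twist

variable {I J : Type*} [Group I] [Group J] {mp : MatchedPair I J} {A : I → I → J} {ξ : I →* J}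

/-- The homomorphism `v ↦ A(1, v)⁻¹` attached to a braiding. -/
def IsBraiding.leftHom (hB : IsBraiding mp A ξ) : I →* J :=
  MonoidHom.mk' (fun v => (A 1 v)⁻¹) fun c d => by
    rw [hB.map_mul, mp.one_act, mul_inv_rev]

lemma IsBraiding.leftHom_apply (hB : IsBraiding mp A ξ) (v : I) : hB.leftHom v = (A 1 v)⁻¹ := rfl

lemma IsBraiding.leftHom_mul (hB : IsBraiding mp A ξ) (v : I) (x : J) :
    hB.leftHom v * x = mp.co v x * hB.leftHom (mp.act v x) := by
  rw [hB.leftHom_apply, hB.leftHom_apply, inv_mul_eq_iff_eq_mul, ← mul_assoc, hB.mul_left,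
    mul_inv_cancel_right]

lemma IsBraiding.apply_act_inv (hB : IsBraiding mp A ξ) (a b : I) :
    A a (mp.act b (ξ a)⁻¹) = (hB.leftHom b)⁻¹ := by
  have := hB.mul_map a⁻¹ a b
  rw [inv_mul_cancel, map_inv] at this
  rw [hB.leftHom_apply, inv_inv, this]

/-- This is the braid relation at `a` and b ◁ ξ(a)⁻¹, the shift being chosen to make `A` depend on
`b` alone. -/
lemma IsBraiding.peiffer (hB : IsBraiding mp A ξ) (a b : I) :
    mp.act b (ξ a)⁻¹ * a = mp.act a (hB.leftHom b)⁻¹ * b := by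
  rw [hB.braid, hB.apply_act_inv, mp.act_inv_act]

/-- An element of the second kernel is an element of J times the element of the first kernel with
the same index. In that form commutation follows from `peiffer` and the group law `graph_mul`. -/
lemma IsBraiding.commute_ker (hB : IsBraiding mp A ξ) {w z : mp.Product}
    (hw : w ∈ (MatchedPair.retraction ξ hB.mul_right).ker)
    (hz : z ∈ (MatchedPair.retraction hB.leftHom hB.leftHom_mul).ker) : z * w = w * z := by
  obtain ⟨b, hb⟩ := (MatchedPair.graphEquiv hB.leftHom hB.leftHom_mul).surjective ⟨z, hz⟩
  obtain ⟨a, ha⟩ := (MatchedPair.graphEquiv ξ hB.mul_right).surjective ⟨w, hw⟩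
  obtain rfl : mp.graph hB.leftHom b = z := congrArg Subtype.val hb
  obtain rfl : mp.graph ξ a = w := congrArg Subtype.val ha
  have h1 : mp.graph hB.leftHom b = mp.inr ((hB.leftHom b)⁻¹ * ξ b) * mp.graph ξ b := by
    rw [MatchedPair.graph, MatchedPair.graph, ← mul_assoc, ← _root_.map_mul,
      mul_inv_cancel_right]
  have h2 := MatchedPair.graph_act hB.mul_right a ((hB.leftHom b)⁻¹ * ξ b)
  have h3 : mp.graph ξ b * mp.graph ξ a =
      mp.graph ξ (mp.act a ((hB.leftHom b)⁻¹ * ξ b)) * mp.graph ξ b := by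
    rw [MatchedPair.graph_mul hB.mul_right, MatchedPair.graph_mul hB.mul_right, hB.peiffer,
      ← mp.act_mul, mul_inv_cancel_right]
  rw [h1, mul_assoc, h3, h2]
  group

variable {H : Type*} [Ring H] [HopfAlgebra ℂ H] [Fintype I] [DecidableEq I]
  {e : Module.Basis (I × J) ℂ H}

/-- The twist `∑ e(u, ξ(v)⁻¹) ⊗ e(v, 1)`. -/
noncomputable def IsBicrossedBasis.twist (he : IsBicrossedBasis mp e) (ξ : I →* J) :
    (H ⊗[ℂ] H)ˣ where
  val := two e 1 (fun _ v => (ξ v)⁻¹) 1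
  inv := two e 1 (fun _ v => ξ v) 1
  val_inv := by
    rw [he.two_mul, he.one_eq_two]
    exact two_congr (fun _ _ => by simp) fun _ _ _ => by simp [mp.act_one]
  inv_val := by
    rw [he.two_mul, he.one_eq_two]
    exact two_congr (fun _ _ => by simp) fun _ _ _ => by simp [mp.act_one]

lemma IsBicrossedBasis.coe_twist (he : IsBicrossedBasis mp e) (ξ : I →* J) :
    (he.twist ξ : H ⊗[ℂ] H) = two e 1 (fun _ v => (ξ v)⁻¹) 1 := rfl

variable {H' : Type*} [Ring H'] [HopfAlgebra ℂ H'] {f : Module.Basis (I × J) ℂ H'}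

/-- Conjugation by the twist changes the product in Δ to the kernel law (a ◁ ξ(b)⁻¹) b, and the
label in the first leg to ξ(b)⁻¹ (b ▷ x) ξ(b ◁ x) = x. -/
lemma IsBicrossedBasis.isQuasiIso_twist (he : IsBicrossedBasis mp e)
    (hξ : ∀ i x, ξ i * x = mp.co i x * ξ (mp.act i x)) {φ : H' ≃ₐ[ℂ] H}
    (hφ : ∀ p, φ (f p) = e p)
    (hcounit : ∀ u x, Coalgebra.counit (R := ℂ) (f (u, x)) = if u = 1 then 1 else 0)
    (hcomul : ∀ u x, Coalgebra.comul (R := ℂ) (f (u, x)) =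
      two f (fun a b => if mp.act a (ξ b)⁻¹ * b = u then 1 else 0) (fun _ _ => x) fun _ _ => x) :
    IsQuasiIso φ (he.twist ξ) where
  counit_map a := by
    have : Coalgebra.counit ∘ₗ φ.toLinearMap = Coalgebra.counit (R := ℂ) (A := H') := by
      refine f.ext fun ⟨u, x⟩ => ?_
      simp [hφ, hcounit, he.counit]
    exact congr($this a)
  map_comul a := by
    rw [Units.eq_mul_inv_iff_mul_eq]
    have : LinearMap.mulRight ℂ (he.twist ξ : H ⊗[ℂ] H) ∘ₗ
        TensorProduct.map φ.toLinearMap φ.toLinearMap ∘ₗ Coalgebra.comul =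
        LinearMap.mulLeft ℂ (he.twist ξ : H ⊗[ℂ] H) ∘ₗ Coalgebra.comul ∘ₗ φ.toLinearMap := by
      refine f.ext fun ⟨u, x⟩ => ?_
      have hmap (r : I → I → ℂ) (a b : I → I → J) :
          TensorProduct.map φ.toLinearMap φ.toLinearMap (two f r a b) = two e r a b := by
        simp [two, hφ]
      simp only [LinearMap.comp_apply, LinearMap.mulRight_apply, LinearMap.mulLeft_apply,
        AlgEquiv.toLinearMap_apply, hφ, hcomul, hmap]
      rw [he.coe_twist, he.comul_eq_two, he.two_mul, he.two_mul]
      refine two_congr (fun a b => by simp [mp.act_one]) fun a b _ => ?_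
      simp only [Pi.one_apply, mp.act_one, one_mul, mul_one, and_true]
      rw [mul_inv_eq_iff_eq_mul, mul_assoc, ← hξ, inv_mul_cancel_left]
    exact congr($this a)
  cocycle := by
    rw [he.coe_twist, he.assoc_two_tmul_one, he.rTensor_comul_two, he.one_tmul_two,
      he.lTensor_comul_two, he.three_mul, he.three_mul]
    refine three_congr (fun _ _ _ => by simp) (fun u v w => ?_) (fun _ _ _ => ?_) fun _ _ _ => ?_
    · simp only [Pi.one_apply, mp.act_one, one_mul]
      rw [inv_mul_eq_iff_eq_mul, eq_comm, map_mul, mul_inv_rev, ← mul_assoc,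
        mul_inv_eq_iff_eq_mul, hξ]
    · simp [mp.co_one, mp.act_one]
    · simp
  counit_rTensor := by
    rw [he.coe_twist, he.lid_counit_two, he.one]
    simp
  counit_lTensor := by
    rw [he.coe_twist, he.rid_counit_two, he.one]
    simp

/-- The factor ξ(u)⁻¹ contributed by τ(T) cancels the label ξ(u) in the second leg of R, which is
what normality requires. -/
lemma IsBicrossedBasis.comm_twist_mul (he : IsBicrossedBasis mp e) (hB : IsBraiding mp A ξ) :
    two e 1 (fun _ v => (hB.leftHom v)⁻¹ * ξ v) 1 =
      TensorProduct.comm ℂ H H (he.twist ξ : H ⊗[ℂ] H) * two e 1 A (fun u _ => ξ u) *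
        (↑(he.twist ξ)⁻¹ : H ⊗[ℂ] H) := by
  rw [Units.eq_mul_inv_iff_mul_eq, he.coe_twist, comm_two, he.two_mul, he.two_mul]
  refine two_congr (fun _ _ => by simp) fun u v _ => ?_
  simp [mp.act_one, hB.apply_act_inv]

end Twist

lemma tensorProduct_repr_nonneg {V ι κ : Type*} [AddCommGroup V] [Module ℂ V]
    {b : Module.Basis ι ℂ V} {e : Module.Basis κ ℂ V} (f : κ ≃ ι) {l : κ → ℝ} (hl : ∀ p, 0 < l p)
    (he : ∀ p, e p = (l p : ℂ) • b (f p)) {t : V ⊗[ℂ] V}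
    (ht : ∀ i j, 0 ≤ (b.tensorProduct b).repr t (i, j)) (p q : κ) :
    0 ≤ (e.tensorProduct e).repr t (p, q) := by
  refine repr_nonneg_of_smul (f.prodCongr f) (l := fun p => l p.1 * l p.2)
    (fun p => mul_pos (hl _) (hl _)) (fun p => ?_) (fun i => ht i.1 i.2) (p, q)
  rw [Module.Basis.tensorProduct_apply', he, he, TensorProduct.smul_tmul_smul]
  simp [Module.Basis.tensorProduct_apply']

theorem IsBicrossedBasis.exists_isNormal {I J : Type} [Group I] [Group J] [Fintype I] [Finite J]
    [DecidableEq I] {mp : MatchedPair I J} {A : I → I → J} {ξ : I →* J} {H : Type*} [Ring H]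
    [HopfAlgebra ℂ H] {e : Module.Basis (I × J) ℂ H} (he : IsBicrossedBasis mp e)
    (hB : IsBraiding mp A ξ) :
    ∃ (G : Type) (_ : Group G) (_ : Fintype G) (P N : Subgroup G) (hPN : P.IsComplement' N)
      (R' : BicrossedHopf hPN ⊗[ℂ] BicrossedHopf hPN),
      IsNormal hPN R' ∧ QuasiIsomorphic R' (two e 1 A fun u _ => ξ u) := by
  classical
  let ρξ := MatchedPair.retraction ξ hB.mul_right
  let ρη := MatchedPair.retraction hB.leftHom hB.leftHom_mul
  have := Fintype.ofFinite mp.Product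
  have hPN := isComplement_ker_range ρξ mp.inr (MatchedPair.retraction_inr _ _)
  have := Fintype.ofFinite ρξ.ker
  have hinj : Function.Injective mp.inr := fun x y h => congrArg MatchedPair.Product.fst h
  let β : J ≃* mp.inr.range := MonoidHom.ofInjective hinj
  -- Only a bijection: I and the kernel generally carry different group laws, and the twist accounts
  -- for the difference.
  let α : I ≃ ρξ.ker := MatchedPair.graphEquiv ξ hB.mul_right
  have hα (u : I) : (α u : mp.Product) = mp.graph ξ u := rfl
  have hβ (x : J) : (β x : mp.Product) = mp.inr x := rfl
  let ρ : mp.Product →* mp.inr.range := β.toMonoidHom.comp ρη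
  have hρ (x : mp.inr.range) : ρ x = x := by
    obtain ⟨x, rfl⟩ := β.surjective x
    exact congrArg β (MatchedPair.retraction_inr _ _ x)
  have hcomm : ∀ u ∈ ρξ.ker, ∀ z ∈ ρ.ker, z * u = u * z := by
    intro u hu z hz
    refine hB.commute_ker hu ?_
    have : β (ρη z) = 1 := hz
    rwa [map_eq_one_iff β β.injective] at this
  have hact (u : I) (x : J) :
      (semidirectPair ρξ.ker mp.inr.range).act (α u) (β x) = α (mp.act u x) := by
    ext1
    rw [semidirectPair_act, hα, hα, hβ, MatchedPair.graph_act hB.mul_right]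
  have he' := BicrossedHopf.isBicrossedBasis_pairBasis hPN
  let f : Module.Basis (I × J) ℂ (BicrossedHopf hPN) :=
    (BicrossedHopf.pairBasis hPN).reindex (α.prodCongr β.toEquiv).symm
  have hf (u x) : f (u, x) = BicrossedHopf.pairBasis hPN (α u, β x) := by simp [f]
  have htwo (r : ρξ.ker → ρξ.ker → ℂ) (a b : I → I → J) :
      two (BicrossedHopf.pairBasis hPN) r (fun u v => β (a (α.symm u) (α.symm v)))
        (fun u v => β (b (α.symm u) (α.symm v))) = two f (fun u v => r (α u) (α v)) a b := by
    refine (Fintype.sum_equiv α _ _ fun u => Fintype.sum_equiv α _ _ fun v => ?_).symm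
    simp [hf]
  obtain ⟨φ, hφ⟩ := exists_algEquiv_of_bases f e fun ⟨u, x⟩ ⟨v, y⟩ => by
    rw [hf, hf, he'.mul, he.mul, hact, ← map_mul, ← hf]
    simp only [EmbeddingLike.apply_eq_iff_eq]
    split_ifs <;> simp
  refine ⟨mp.Product, inferInstance, inferInstance, _, _, hPN, _, isNormal_two hPN ρ hρ hcomm,
    φ, he.twist ξ, he.isQuasiIso_twist hB.mul_right hφ ?_ ?_, ?_⟩
  · intro u x
    rw [hf, he'.counit]
    have h1 : α 1 = 1 := by
      ext1
      rw [hα, MatchedPair.graph]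
      simp
    rw [← h1]
    simp
  · intro u x
    rw [hf, he'.comul_eq_two]
    refine (htwo _ (fun _ _ => x) (fun _ _ => x)).trans (two_congr (fun a b => ?_) fun _ _ _ =>
      ⟨rfl, rfl⟩)
    have : α a * α b = α (mp.act a (ξ b)⁻¹ * b) := by
      ext1
      rw [Subgroup.coe_mul, hα, hα, hα, MatchedPair.graph_mul hB.mul_right]
    rw [this]
    simp
  · rw [← he.comm_twist_mul hB]
    have h1 : two (BicrossedHopf.pairBasis hPN) 1 (fun _ v => (ρ v)⁻¹) 1 =
        two f 1 (fun _ v => (hB.leftHom v)⁻¹ * ξ v) 1 := by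
      refine Eq.trans (two_congr (fun _ _ => rfl) fun u v _ => ⟨?_, ?_⟩) (htwo 1 _ _)
      -- The second retraction sends ξ(v)⁻¹v to ξ(v)⁻¹η(v), whose inverse is the label found in
      -- `comm_twist_mul`.
      · obtain ⟨v, rfl⟩ := α.surjective v
        rw [Equiv.symm_apply_apply, inv_eq_iff_eq_inv, ← map_inv]
        refine congrArg β ?_
        change ρη (mp.graph ξ v) = _
        simp [ρη, MatchedPair.graph]
      · simp
    rw [h1]
    simp [two, hφ]

end PositiveHopf

theorem theorem3 {H : Type*} [Ring H] [HopfAlgebra ℂ H] {ι : Type*} [Finite ι]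
    (b : Module.Basis ι ℂ H) (hb : PositiveHopf.IsPositiveBasis b)
    (R : H ⊗[ℂ] H) (hR : PositiveHopf.IsQuasiTriangular R)
    (hRpos : PositiveHopf.IsPositive b R) :
    ∃ (G : Type) (_ : Group G) (_ : Fintype G) (P N : Subgroup G) (hPN : P.IsComplement' N)
      (R' : PositiveHopf.BicrossedHopf hPN ⊗[ℂ] PositiveHopf.BicrossedHopf hPN),
      PositiveHopf.IsNormal hPN R' ∧ PositiveHopf.QuasiIsomorphic R' R := by
  -- The index type is replaced by `Fin n` so that the groups built from it live in `Type`.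
  obtain ⟨n, ⟨g⟩⟩ := Finite.exists_equiv_fin ι
  have hb' : PositiveHopf.IsPositiveBasis (b.reindex g) := by
    constructor <;> intros <;>
      simp only [Module.Basis.reindex_apply, Module.Basis.repr_reindex_apply]
    · exact hb.mul_nonneg _ _ _
    · exact hb.one_nonneg _
    · exact PositiveHopf.tensorProduct_repr_nonneg g.symm (l := fun _ => 1)
        (fun _ => one_pos) (fun p => by simp) (hb.comul_nonneg _) _ _
    · exact hb.counit_nonneg _
    · exact hb.antipode_nonneg _ _
  obtain ⟨I, J, _, _, _, _, _, mp, e, f, l, he, hl, hel⟩ := hb'.exists_isBicrossedBasis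
  have hel' (p) : e p = (l p : ℂ) • b ((f.trans g.symm) p) := by simp [hel p]
  have hS (p q) : 0 ≤ e.repr (HopfAlgebra.antipode ℂ (e p)) q := by
    refine PositiveHopf.repr_nonneg_of_smul (f.trans g.symm) hl hel' (fun i => ?_) q
    rw [hel', map_smul, map_smul, Finsupp.smul_apply, smul_eq_mul]
    exact mul_nonneg (Complex.zero_le_real.2 (hl p).le) (hb.antipode_nonneg _ _)
  obtain ⟨A, ξ, hB, rfl⟩ := he.exists_isBraiding hS hR
    (PositiveHopf.tensorProduct_repr_nonneg (f.trans g.symm) hl hel' hRpos)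
  exact he.exists_isNormal hB
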